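/- Let $d\ge 1$ be an integer, $s\in\mathbb R$ and $p_1,p_2,q_1,q_2\in(0,\infty]$, with the convention $1/\infty=0$. Put $v_s(\xi)=(1+|\xi|^2)^{s/2}$ for $\xi\in\mathbb R^d$, where $|\xi|$ is the Euclidean norm, and $(1\otimes v_s)(x,\xi)=v_s(\xi)$. For $p,q\in(0,\infty]$ and a positive function $m$ on $\mathbb R^{2d}$, let $l^{(p,q)}_m(\mathbb Z^{2d})$ be the space of all complex sequences $\vec a=(a_{k,n})_{k,n\in\mathbb Z^d}$ for which $$\|\vec a\|_{l^{(p,q)}_m}=\Big(\sum_{k\in\mathbb Z^d}\Big(\sum_{n\in\mathbb Z^d}|a_{k,n}|^q\,m(k,n)^q\Big)^{p/q}\Big)^{1/p}$$ is finite, with suprema in place of sums when $p=\infty$ or $q=\infty$; write $l^{(p,q)}=l^{(p,q)}_m$ when $m\equiv1$. Let $\mathcal T$ be the shear $(\mathcal T\vec a)_{k,n}=a_{k-n,n}$, and put $A=d(1/p_2-1/q_1)$, $B=d(1/q_2-1/p_1)$. Then $\mathcal T$ is bounded from $l^{(p_1,q_1)}_{1\otimes v_s}(\mathbb Z^{2d})$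 to $l^{(p_2,q_2)}(\mathbb Z^{2d})$, that is, there is a constant $C<\infty$ such that for every $\vec a\in l^{(p_1,q_1)}_{1\otimes v_s}(\mathbb Z^{2d})$ we have $\mathcal T\vec a\in l^{(p_2,q_2)}(\mathbb Z^{2d})$ and $\|\mathcal T\vec a\|_{l^{(p_2,q_2)}}\le C\|\vec a\|_{l^{(p_1,q_1)}_{1\otimes v_s}}$, if and only if $1/p_2\le 1/p_1$ and $$s\ \ge\ \max\{A,\;B,\;A+B,\;0\},$$ with strict inequality if one of the following cases happens: (1) $A>0\ge B$; (2) $B>0\ge A$; (3) $A>0$, $B>0$ and $p_1=p_2$. -/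

import Mathlib

open scoped ENNReal NNReal

noncomputable section

namespace ShearMixedNorm

/-- The integer lattice `ℤ^d`. -/
abbrev Lattice (d : ℕ) : Type := Fin d → ℤ

/-- Double sequences `a = (a_{k,n})`, `k, n ∈ ℤ^d`, with complex entries. -/
abbrev Seq (d : ℕ) : Type := Lattice d → Lattice d → ℂ

/-- A lattice point regarded as a point of Euclidean space `ℝ^d`. -/
def toEuclid {d : ℕ} (n : Lattice d) : EuclideanSpace ℝ (Fin d) :=
  WithLp.toLp 2 (fun i => (n i : ℝ))

/-- The power weight `v_s(ξ) = (1 + |ξ|²)^{s/2}` on `ℝ^d`, where `|ξ|` is the Euclidean norm. -/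
def powerWeight {d : ℕ} (s : ℝ) (ξ : EuclideanSpace ℝ (Fin d)) : ℝ :=
  (1 + ‖ξ‖ ^ 2) ^ (s / 2)

/-- The weight `(1 ⊗ v_s)(x, ξ) = v_s(ξ)` on `ℝ^d × ℝ^d`. -/
def oneTensorPower {d : ℕ} (s : ℝ) (_x ξ : EuclideanSpace ℝ (Fin d)) : ℝ :=
  powerWeight s ξ

/-- The `l^q` (quasi-)norm of a nonnegative family, for `0 < q ≤ ∞`, with values in `[0, ∞]`. -/
def lqNorm {ι : Type*} (q : ℝ≥0∞) (f : ι → ℝ≥0∞) : ℝ≥0∞ :=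
  if q = ∞ then ⨆ n, f n else (∑' n, f n ^ q.toReal) ^ (1 / q.toReal)

/-- The weighted mixed (quasi-)norm
`‖a‖_{l^{(p,q)}_m} = (∑_k (∑_n |a_{k,n}|^q m(k,n)^q)^{p/q})^{1/p}`, with suprema for infinite
exponents, and with the value `∞` for sequences outside of the space. -/
def mixedNorm {d : ℕ} (p q : ℝ≥0∞)
    (m : EuclideanSpace ℝ (Fin d) → EuclideanSpace ℝ (Fin d) → ℝ) (a : Seq d) : ℝ≥0∞ :=
  lqNorm p (fun k => lqNorm q (fun n =>
    ENNReal.ofReal (‖a k n‖ * m (toEuclid k) (toEuclid n))))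

/-- The space `l^{(p,q)}_m(ℤ^{2d})`. -/
def mixedSpace {d : ℕ} (p q : ℝ≥0∞)
    (m : EuclideanSpace ℝ (Fin d) → EuclideanSpace ℝ (Fin d) → ℝ) : Set (Seq d) :=
  {a | mixedNorm p q m a < ∞}

/-- The shear `(T a)_{k,n} = a_{k-n,n}`, a linear map on double sequences. -/
def shear (d : ℕ) : Seq d →ₗ[ℂ] Seq d where
  toFun a := fun k n => a (k - n) n
  map_add' _ _ := rfl
  map_smul' _ _ := rfl

/-- A linear map on double sequences is bounded from `l^{(p₁,q₁)}_{m₁}` to `l^{(p₂,q₂)}_{m₂}`: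
it maps the first space into the second one, with a norm bound uniform in the sequence. -/
def IsBoundedMap {d : ℕ} (T : Seq d →ₗ[ℂ] Seq d)
    (p₁ q₁ : ℝ≥0∞) (m₁ : EuclideanSpace ℝ (Fin d) → EuclideanSpace ℝ (Fin d) → ℝ)
    (p₂ q₂ : ℝ≥0∞) (m₂ : EuclideanSpace ℝ (Fin d) → EuclideanSpace ℝ (Fin d) → ℝ) : Prop :=
  ∃ C : ℝ≥0, ∀ a ∈ mixedSpace p₁ q₁ m₁,
    T a ∈ mixedSpace p₂ q₂ m₂ ∧ mixedNorm p₂ q₂ m₂ (T a) ≤ C * mixedNorm p₁ q₁ m₁ a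

end ShearMixedNorm

end

/-! Put $G_{j,k}=a_{j,k-j}$. Substituting $n=k-j$ turns the boundedness of the shear into an
estimate that exchanges the two norms: the $l^{p_2}_k l^{q_2}_j$ norm of $G$ against the $l^{p_1}_j
l^{q_1}_k$ norm of $G_{j,k}v_s(k-j)$ (`mixedNorm_shear`, `mixedNorm_oneTensorPower`). For $s\ge 0$
the weight may be replaced by one that is constant on dyadic shells.

Sufficiency: a one-variable embedding from $l^{p_1}$ to $l^{q_2}$ in $j$, Minkowski's inequality
(where $p_1\le p_2$ enters), and an embedding from $l^{q_1}$ to $l^{p_2}$ in $k$. By Hölder the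
embeddings cost a weight exponent above $B$ and above $A$ when these are positive, and nothing
otherwise (`exists_lqNorm_lqNorm_le_of_add`). This leaves the endpoint $s=A+B$ with $A,B>0$ and
$p_1<p_2$, where duality reduces the claim to the discrete Hardy–Littlewood–Sobolev inequality
(`exists_lqNorm_lqNorm_le_endpoint`).

Necessity comes from test families: a single entry ($s\ge0$), the diagonal ($p_1\le p_2$), a row or
a column carrying a truncated critical power ($s>A$ or $s>B$ when these are positive), the indicator
of a cube ($s\ge A+B$), and a convolution kernel on a large cube ($s>A+B$ in case (3)). -/

namespace ShearMixedNorm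

/-! ### Sequence norms: Hölder, duality and Minkowski. -/

section

variable {ι κ : Type*}

lemma lqNorm_top (f : ι → ℝ≥0∞) : lqNorm ∞ f = ⨆ n, f n := if_pos rfl

lemma lqNorm_of_ne_top {q : ℝ≥0∞} (hq : q ≠ ∞) (f : ι → ℝ≥0∞) :
    lqNorm q f = (∑' n, f n ^ q.toReal) ^ (1 / q.toReal) := if_neg hq

lemma lqNorm_rpow {q : ℝ≥0∞} (h0 : 0 < q) (hq : q ≠ ∞) (f : ι → ℝ≥0∞) :
    lqNorm q f ^ q.toReal = ∑' n, f n ^ q.toReal := by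
  have h := ENNReal.toReal_pos h0.ne' hq
  rw [lqNorm_of_ne_top hq, ← ENNReal.rpow_mul, one_div_mul_cancel h.ne', ENNReal.rpow_one]

lemma lqNorm_le_iff {q : ℝ≥0∞} (h0 : 0 < q) (hq : q ≠ ∞) (f : ι → ℝ≥0∞) (M : ℝ≥0∞) :
    lqNorm q f ≤ M ↔ ∑' n, f n ^ q.toReal ≤ M ^ q.toReal := by
  rw [← lqNorm_rpow h0 hq, ENNReal.rpow_le_rpow_iff (ENNReal.toReal_pos h0.ne' hq)]

lemma lqNorm_mono (q : ℝ≥0∞) {f g : ι → ℝ≥0∞} (h : ∀ n, f n ≤ g n) : lqNorm q f ≤ lqNorm q g := by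
  by_cases hq : q = ∞
  · subst hq
    simp only [lqNorm_top]
    exact iSup_mono h
  · simp only [lqNorm_of_ne_top hq]
    exact ENNReal.rpow_le_rpow (ENNReal.tsum_le_tsum fun n =>
      ENNReal.rpow_le_rpow (h n) ENNReal.toReal_nonneg) (by positivity)

lemma lqNorm_const_mul {q : ℝ≥0∞} (h0 : 0 < q) (c : ℝ≥0∞) (f : ι → ℝ≥0∞) :
    lqNorm q (fun n => c * f n) = c * lqNorm q f := by
  by_cases hq : q = ∞
  · subst hq
    simp only [lqNorm_top, ENNReal.mul_iSup]
  · have h := ENNReal.toReal_pos h0.ne' hq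
    simp only [lqNorm_of_ne_top hq, ENNReal.mul_rpow_of_nonneg _ _ h.le, ENNReal.tsum_mul_left]
    rw [ENNReal.mul_rpow_of_nonneg _ _ (by positivity), ← ENNReal.rpow_mul,
      mul_one_div_cancel h.ne', ENNReal.rpow_one]

lemma lqNorm_comp_equiv (q : ℝ≥0∞) (e : ι ≃ κ) (f : κ → ℝ≥0∞) :
    lqNorm q (fun n => f (e n)) = lqNorm q f := by
  by_cases hq : q = ∞
  · subst hq
    simp only [lqNorm_top]
    exact e.iSup_comp (g := f)
  · simp only [lqNorm_of_ne_top hq]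
    rw [e.tsum_eq (fun n => f n ^ q.toReal)]

lemma le_lqNorm {q : ℝ≥0∞} (h0 : 0 < q) (f : ι → ℝ≥0∞) (n : ι) : f n ≤ lqNorm q f := by
  by_cases hq : q = ∞
  · subst hq
    exact (le_iSup f n).trans_eq (lqNorm_top f).symm
  · rw [← ENNReal.rpow_le_rpow_iff (ENNReal.toReal_pos h0.ne' hq), lqNorm_rpow h0 hq]
    exact ENNReal.le_tsum n

/-- Every entry is at most $\|f\|_q$, so $f^{p-q}$ can be pulled out of the sum of $f^{p-q}f^q$. -/
lemma lqNorm_anti {p q : ℝ≥0∞} (h0 : 0 < q) (hqp : q ≤ p) (f : ι → ℝ≥0∞) :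
    lqNorm p f ≤ lqNorm q f := by
  by_cases hp : p = ∞
  · subst hp
    rw [lqNorm_top]
    exact iSup_le fun n => le_lqNorm h0 f n
  · have hq : q ≠ ∞ := fun h => hp (top_le_iff.1 (h ▸ hqp))
    have hr := ENNReal.toReal_pos h0.ne' hq
    have hqp' : q.toReal ≤ p.toReal := ENNReal.toReal_mono hp hqp
    rw [lqNorm_le_iff (h0.trans_le hqp) hp]
    calc ∑' n, f n ^ p.toReal
        = ∑' n, f n ^ (p.toReal - q.toReal) * f n ^ q.toReal := by
          refine tsum_congr fun n => ?_
          rw [← ENNReal.rpow_add_of_nonneg _ _ (sub_nonneg.2 hqp') hr.le, sub_add_cancel]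
      _ ≤ ∑' n, lqNorm q f ^ (p.toReal - q.toReal) * f n ^ q.toReal := by
          refine ENNReal.tsum_le_tsum fun n => mul_le_mul_left (ENNReal.rpow_le_rpow
            (le_lqNorm h0 f n) (sub_nonneg.2 hqp')) _
      _ = lqNorm q f ^ p.toReal := by
          rw [ENNReal.tsum_mul_left, ← lqNorm_rpow h0 hq,
            ← ENNReal.rpow_add_of_nonneg _ _ (sub_nonneg.2 hqp') hr.le, sub_add_cancel]

/-- Hölder's inequality for sums of nonnegative families, with reciprocal exponents. -/
lemma tsum_rpow_mul_rpow_le (f g : ι → ℝ≥0∞) {a b : ℝ} (ha : 0 ≤ a) (hb : 0 ≤ b)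
    (hab : a + b = 1) :
    ∑' i, f i ^ a * g i ^ b ≤ (∑' i, f i) ^ a * (∑' i, g i) ^ b := by
  let _ : MeasurableSpace ι := ⊤
  have h := ENNReal.lintegral_mul_norm_pow_le (μ := MeasureTheory.Measure.count) (f := f) (g := g)
    (Measurable.of_discrete).aemeasurable (Measurable.of_discrete).aemeasurable ha hb hab
  simpa only [MeasureTheory.lintegral_count] using h

/-- Hölder's inequality for sums of nonnegative families. -/
lemma tsum_mul_le (f g : ι → ℝ≥0∞) {a b : ℝ} (ha : 0 < a) (hb : 0 < b)
    (hab : a + b = 1) :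
    ∑' i, f i * g i ≤ (∑' i, f i ^ (1 / a)) ^ a * (∑' i, g i ^ (1 / b)) ^ b := by
  refine le_trans (le_of_eq ?_) (tsum_rpow_mul_rpow_le _ _ ha.le hb.le hab)
  refine tsum_congr fun i => ?_
  rw [← ENNReal.rpow_mul, ← ENNReal.rpow_mul, one_div_mul_cancel ha.ne', one_div_mul_cancel hb.ne',
    ENNReal.rpow_one, ENNReal.rpow_one]

/-- The converse of Hölder's inequality: `a` is the reciprocal of the exponent. -/
lemma tsum_rpow_le_of_dual {x : ι → ℝ≥0∞} {M : ℝ≥0∞} {a : ℝ} (ha : 0 < a) (ha1 : a < 1)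
    (h : ∀ b : ι → ℝ≥0∞, ∑' i, x i * b i ≤ M * (∑' i, b i ^ (1 / (1 - a))) ^ (1 - a)) :
    (∑' i, x i ^ (1 / a)) ^ a ≤ M := by
  classical
  rcases eq_or_ne M ∞ with rfl | hM
  · exact le_top
  have hb : 0 < 1 - a := by linarith
  -- Testing with the indicator of one index bounds each entry by $M$; the finite sums below are
  -- then finite and can be cancelled.
  have hx : ∀ i, x i ≠ ∞ := by
    intro i
    have := h (Pi.single i 1)
    rw [tsum_eq_single i (fun j hj => by simp [hj]), tsum_eq_single i (fun j hj => by
      simp [hj, hb])] at this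
    simp only [Pi.single_eq_same, mul_one, ENNReal.one_rpow] at this
    exact ne_top_of_le_ne_top hM this
  have key : ∀ S : Finset ι, ∑ i ∈ S, x i ^ (1 / a) ≤ M ^ (1 / a) := by
    intro S
    set T := ∑ i ∈ S, x i ^ (1 / a) with hT
    have hTtop : T ≠ ∞ := (ENNReal.sum_lt_top.2 fun i _ =>
      ENNReal.rpow_lt_top_of_nonneg (by positivity) (hx i)).ne
    -- The extremal sequence for Hölder's inequality, cut off to a finite set.
    have h1 := h (fun i => if i ∈ S then x i ^ ((1 - a) / a) else 0)
    rw [tsum_eq_sum (s := S) (fun i hi => by simp [hi]), tsum_eq_sum (s := S) (fun i hi => by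
      simp [hi, hb])] at h1
    have e1 : ∑ i ∈ S, x i * (if i ∈ S then x i ^ ((1 - a) / a) else 0) = T := by
      refine Finset.sum_congr rfl fun i hi => ?_
      rw [if_pos hi]
      nth_rewrite 1 [← ENNReal.rpow_one (x i)]
      rw [← ENNReal.rpow_add_of_nonneg _ _ zero_le_one (by positivity)]
      congr 1
      field_simp
      ring
    have e2 : ∑ i ∈ S, (if i ∈ S then x i ^ ((1 - a) / a) else 0) ^ (1 / (1 - a)) = T := by
      refine Finset.sum_congr rfl fun i hi => ?_
      rw [if_pos hi, ← ENNReal.rpow_mul]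
      congr 1
      field_simp
    rw [e1, e2] at h1
    rcases eq_or_ne T 0 with h0 | h0
    · rw [h0]; exact zero_le
    · have h2 : T ^ a * T ^ (1 - a) ≤ M * T ^ (1 - a) := by
        rw [← ENNReal.rpow_add _ _ h0 hTtop]
        simpa using h1
      have h3 := (ENNReal.mul_le_mul_iff_left (by simp [ENNReal.rpow_eq_zero_iff, h0, hTtop])
        (ENNReal.rpow_ne_top_of_nonneg hb.le hTtop)).1 h2
      calc T = (T ^ a) ^ (1 / a) := by
            rw [← ENNReal.rpow_mul, mul_one_div_cancel ha.ne', ENNReal.rpow_one]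
        _ ≤ _ := ENNReal.rpow_le_rpow h3 (by positivity)
  calc (∑' i, x i ^ (1 / a)) ^ a ≤ (M ^ (1 / a)) ^ a := by
        refine ENNReal.rpow_le_rpow ?_ ha.le
        rw [ENNReal.tsum_eq_iSup_sum]
        exact iSup_le key
    _ = M := by rw [← ENNReal.rpow_mul, one_div_mul_cancel ha.ne', ENNReal.rpow_one]

/-- Minkowski's inequality for infinite sums of nonnegative families; `a` is the reciprocal of
the exponent. -/
lemma tsum_tsum_rpow_le (F : ι → κ → ℝ≥0∞) {a : ℝ} (ha : 0 < a) (ha1 : a ≤ 1) :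
    (∑' k, (∑' j, F j k) ^ (1 / a)) ^ a ≤ ∑' j, (∑' k, F j k ^ (1 / a)) ^ a := by
  rcases ha1.eq_or_lt with rfl | ha1
  · simp only [div_one, ENNReal.rpow_one]
    exact ENNReal.tsum_comm.le
  · refine tsum_rpow_le_of_dual ha ha1 fun b => ?_
    calc ∑' k, (∑' j, F j k) * b k = ∑' j, ∑' k, F j k * b k := by
          simp only [← ENNReal.tsum_mul_right]
          exact ENNReal.tsum_comm
      _ ≤ ∑' j, (∑' k, F j k ^ (1 / a)) ^ a * (∑' i, b i ^ (1 / (1 - a))) ^ (1 - a) :=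
          ENNReal.tsum_le_tsum fun j => tsum_mul_le _ _ ha (by linarith) (by ring)
      _ = _ := ENNReal.tsum_mul_right

/-- Minkowski's inequality for mixed norms: exchanging the order of the norms. -/
lemma lqNorm_lqNorm_le {p q : ℝ≥0∞} (hp : 0 < p) (hpq : p ≤ q) (G : ι → κ → ℝ≥0∞) :
    lqNorm q (fun k => lqNorm p fun j => G j k) ≤ lqNorm p fun j => lqNorm q fun k => G j k := by
  by_cases hq : q = ∞
  · subst hq
    rw [lqNorm_top]
    refine iSup_le fun k => lqNorm_mono p fun j => ?_
    exact le_lqNorm (hp.trans_le hpq) (fun k => G j k) k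
  · have hp' : p ≠ ∞ := fun h => hq (top_le_iff.1 (h ▸ hpq))
    have hr := ENNReal.toReal_pos hp.ne' hp'
    have hs := ENNReal.toReal_pos (hp.trans_le hpq).ne' hq
    have hrs : p.toReal ≤ q.toReal := ENNReal.toReal_mono hq hpq
    -- After taking $p$-th powers the claim is Minkowski's inequality in $l^{q/p}$.
    have h := tsum_tsum_rpow_le (fun j k => G j k ^ p.toReal) (a := p.toReal / q.toReal)
      (by positivity) ((div_le_one hs).2 hrs)
    simp only [lqNorm_of_ne_top hq, lqNorm_of_ne_top hp', ← ENNReal.rpow_mul] at h ⊢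
    have e1 : p.toReal * (1 / (p.toReal / q.toReal)) = q.toReal := by field_simp
    have e2 : 1 / (p.toReal / q.toReal) = 1 / p.toReal * q.toReal := by field_simp
    have e3 : p.toReal / q.toReal = 1 / q.toReal * p.toReal := by field_simp
    have e4 : 1 / q.toReal = p.toReal / q.toReal * (1 / p.toReal) := by field_simp
    rw [e1] at h
    rw [e2] at h
    have h' := ENNReal.rpow_le_rpow h (z := 1 / p.toReal) (by positivity)
    rw [← ENNReal.rpow_mul, ← e4] at h'
    rw [e3] at h'
    exact h'

/-- The exponent `(1 / q).toReal` is $0$ at $q=\infty$, so one formula covers all exponents. -/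
lemma lqNorm_indicator {q : ℝ≥0∞} (h0 : 0 < q) (S : Finset ι) [DecidablePred (· ∈ S)]
    (hS : S.Nonempty) (c : ℝ≥0∞) :
    lqNorm q (fun n => if n ∈ S then c else 0) = (S.card : ℝ≥0∞) ^ (1 / q).toReal * c := by
  by_cases hq : q = ∞
  · subst hq
    rw [lqNorm_top]
    simp only [ENNReal.div_top, ENNReal.toReal_zero, ENNReal.rpow_zero, one_mul]
    obtain ⟨n, hn⟩ := hS
    refine le_antisymm (iSup_le fun m => by split_ifs <;> simp) ?_
    refine le_trans ?_ (le_iSup _ n)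
    simp [hn]
  · have h := ENNReal.toReal_pos h0.ne' hq
    rw [lqNorm_of_ne_top hq, tsum_eq_sum (s := S) (fun i hi => by simp [hi, h]),
      Finset.sum_congr rfl (g := fun _ => c ^ q.toReal) (fun i hi => by simp [hi]),
      Finset.sum_const, nsmul_eq_mul, ENNReal.mul_rpow_of_nonneg _ _ (by positivity),
      ← ENNReal.rpow_mul, mul_one_div_cancel h.ne', ENNReal.rpow_one]
    simp

lemma lqNorm_zero {q : ℝ≥0∞} (h0 : 0 < q) : lqNorm q (fun _ : ι => 0) = 0 := by
  simpa using lqNorm_const_mul h0 0 (fun _ : ι => 0)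

lemma lqNorm_single {q : ℝ≥0∞} (h0 : 0 < q) (m : ι) (f : ι → ℝ≥0∞) (hf : ∀ n, n ≠ m → f n = 0) :
    lqNorm q f = f m := by
  classical
  have := lqNorm_indicator h0 {m} (Finset.singleton_nonempty m) (f m)
  simp only [Finset.card_singleton, Nat.cast_one, ENNReal.one_rpow, one_mul] at this
  rw [← this]
  congr 1
  ext n
  by_cases h : n = m
  · simp [h]
  · simp [h, hf n h]

end

/-! ### Dyadic shells, dyadic weights and geometric sums. -/

section

variable {d : ℕ}

/-- The index of the dyadic shell of a lattice point, for the sup norm. -/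
def shellIndex (n : Lattice d) : ℕ := Nat.log 2 (1 + Finset.univ.sup fun i => (n i).natAbs)

/-- The `i`-th dyadic shell of the lattice. -/
noncomputable def shell (d i : ℕ) : Finset (Lattice d) :=
  (Fintype.piFinset fun _ => Finset.Ico (-2 ^ (i + 1) : ℤ) (2 ^ (i + 1))).filter
    fun n => shellIndex n = i

/-- A dyadic model of the power weight. -/
noncomputable def dyadicWeight (s : ℝ) (n : Lattice d) : ℝ≥0∞ := 2 ^ (s * shellIndex n)

lemma two_pow_shellIndex_le (n : Lattice d) :
    2 ^ shellIndex n ≤ 1 + Finset.univ.sup fun i => (n i).natAbs :=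
  Nat.pow_log_le_self 2 (by omega)

lemma lt_two_pow_shellIndex (n : Lattice d) :
    1 + Finset.univ.sup (fun i => (n i).natAbs) < 2 ^ (shellIndex n + 1) :=
  Nat.lt_pow_succ_log_self one_lt_two _

lemma natAbs_lt_two_pow_shellIndex (n : Lattice d) (j : Fin d) :
    (n j).natAbs < 2 ^ (shellIndex n + 1) := by
  have h1 := lt_two_pow_shellIndex n
  have h2 := Finset.le_sup (f := fun i => (n i).natAbs) (Finset.mem_univ j)
  omega

-- The box in `shell` only provides finiteness: it contains every point of index $i$.
@[simp] lemma mem_shell {i : ℕ} {n : Lattice d} : n ∈ shell d i ↔ shellIndex n = i := by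
  simp only [shell, Finset.mem_filter, and_iff_right_iff_imp]
  rintro rfl
  rw [Fintype.mem_piFinset]
  intro j
  have h := natAbs_lt_two_pow_shellIndex n j
  zify at h
  rw [Finset.mem_Ico]
  rw [abs_lt] at h
  exact ⟨h.1.le, h.2⟩

lemma card_shell_le (d i : ℕ) : (shell d i).card ≤ 4 ^ d * (2 ^ i) ^ d := by
  refine (Finset.card_filter_le _ _).trans (le_of_eq ?_)
  rw [Fintype.card_piFinset, Finset.prod_const, Finset.card_univ, Fintype.card_fin, ← mul_pow,
    Int.card_Ico]
  congr 1
  zify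
  rw [Int.toNat_of_nonneg (by linarith [pow_pos (two_pos : (0 : ℤ) < 2) (i + 1)])]
  ring

/-- The shell contains the cube $[2^i-1,2^{i+1}-1)^d$; $d\ge1$ supplies a coordinate that bounds the
sup norm from below. -/
lemma le_card_shell (hd : 1 ≤ d) (i : ℕ) : (2 ^ i) ^ d ≤ (shell d i).card := by
  have h : (Fintype.piFinset fun _ : Fin d => Finset.Ico (2 ^ i - 1 : ℤ) (2 ^ (i + 1) - 1)).card
      = (2 ^ i) ^ d := by
    rw [Fintype.card_piFinset, Finset.prod_const, Finset.card_univ, Fintype.card_fin,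
      Int.card_Ico]
    congr 1
    zify
    rw [Int.toNat_of_nonneg (by rw [pow_succ]; linarith [pow_pos (two_pos : (0 : ℤ) < 2) i])]
    ring
  rw [← h]
  refine Finset.card_le_card fun n hn => ?_
  rw [Fintype.mem_piFinset] at hn
  rw [mem_shell, shellIndex, Nat.log_eq_iff (Or.inr ⟨one_lt_two, by omega⟩)]
  have hp : (1 : ℤ) ≤ 2 ^ i := one_le_pow₀ (by norm_num)
  constructor
  · have h2 := Finset.le_sup (f := fun i => (n i).natAbs) (Finset.mem_univ (⟨0, hd⟩ : Fin d))
    have h3 := (Finset.mem_Ico.1 (hn ⟨0, hd⟩)).1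
    have h4 := Int.le_natAbs (a := n ⟨0, hd⟩)
    zify
    zify at h2 h4
    linarith
  · rw [add_comm, ← Nat.lt_sub_iff_add_lt]
    rw [Finset.sup_lt_iff (by simp)]
    intro j _
    have h3 := Finset.mem_Ico.1 (hn j)
    rw [Nat.lt_sub_iff_add_lt]
    zify
    rw [abs_of_nonneg (by linarith)]
    linarith

lemma tsum_eq_tsum_shell (f : Lattice d → ℝ≥0∞) : ∑' n, f n = ∑' i, ∑ n ∈ shell d i, f n := by
  calc ∑' n, f n = ∑' n, ∑' i, if shellIndex n = i then f n else 0 := by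
        refine tsum_congr fun n => ?_
        rw [tsum_eq_single (shellIndex n) fun i hi => if_neg hi.symm, if_pos rfl]
    _ = ∑' i, ∑' n, if shellIndex n = i then f n else 0 := ENNReal.tsum_comm
    _ = _ := by
        refine tsum_congr fun i => ?_
        rw [tsum_eq_sum (s := shell d i) (fun n hn => if_neg (by simpa using hn))]
        exact Finset.sum_congr rfl fun n hn => if_pos (by simpa using hn)

lemma dyadicWeight_ne_top (s : ℝ) (n : Lattice d) : dyadicWeight s n ≠ ∞ :=
  ENNReal.rpow_ne_top_of_ne_zero (by simp) (by simp)

lemma dyadicWeight_mul (s t : ℝ) (n : Lattice d) :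
    dyadicWeight s n * dyadicWeight t n = dyadicWeight (s + t) n := by
  rw [dyadicWeight, dyadicWeight, dyadicWeight, ← ENNReal.rpow_add _ _ (by simp) (by simp), add_mul]

@[simp] lemma dyadicWeight_zero (n : Lattice d) : dyadicWeight 0 n = 1 := by
  simp [dyadicWeight]

lemma dyadicWeight_rpow (s r : ℝ) (n : Lattice d) :
    dyadicWeight s n ^ r = dyadicWeight (s * r) n := by
  rw [dyadicWeight, dyadicWeight, ← ENNReal.rpow_mul]
  ring_nf

lemma dyadicWeight_neg_arg (s : ℝ) (n : Lattice d) : dyadicWeight s (-n) = dyadicWeight s n := by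
  simp [dyadicWeight, shellIndex]

lemma dyadicWeight_mono {s t : ℝ} (h : s ≤ t) (n : Lattice d) :
    dyadicWeight s n ≤ dyadicWeight t n :=
  ENNReal.rpow_le_rpow_of_exponent_le (by norm_num) (by gcongr)

lemma tsum_two_rpow_neg {δ : ℝ} (hδ : 0 < δ) : ∑' i : ℕ, (2 : ℝ≥0∞) ^ (-δ * i) ≠ ∞ := by
  have : ∀ i : ℕ, (2 : ℝ≥0∞) ^ (-δ * i) = ((2 : ℝ≥0∞) ^ (-δ)) ^ i := fun i => by
    rw [ENNReal.rpow_mul, ENNReal.rpow_natCast]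
  simp only [this]
  rw [ENNReal.tsum_geometric]
  refine ENNReal.inv_ne_top.2 (tsub_pos_of_lt ?_).ne'
  exact ENNReal.rpow_lt_one_of_one_lt_of_neg (by norm_num) (by linarith)

/-- Uniformity in $\tau$ is the point: replacing $\tau$ by its floor costs a factor $2^\delta$ and
leaves part of a fixed sum over $\mathbb Z$. -/
lemma exists_tsum_two_rpow_neg_abs_le {δ : ℝ} (hδ : 0 < δ) :
    ∃ C : ℝ≥0∞, C ≠ ∞ ∧ ∀ τ : ℝ, ∑' i : ℕ, (2 : ℝ≥0∞) ^ (-δ * |i - τ|) ≤ C := by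
  have hZ : ∑' z : ℤ, (2 : ℝ≥0∞) ^ (-δ * |(z : ℝ)|) ≠ ∞ := by
    rw [tsum_of_nat_of_neg_add_one ENNReal.summable ENNReal.summable]
    refine ENNReal.add_ne_top.2 ⟨?_, ?_⟩
    · simpa using tsum_two_rpow_neg hδ
    · refine ne_top_of_le_ne_top (tsum_two_rpow_neg hδ) (ENNReal.tsum_le_tsum fun i => ?_)
      refine ENNReal.rpow_le_rpow_of_exponent_le (by norm_num) ?_
      push_cast
      rw [abs_neg, abs_of_nonneg (by positivity)]
      nlinarith
  refine ⟨2 ^ δ * ∑' z : ℤ, (2 : ℝ≥0∞) ^ (-δ * |(z : ℝ)|),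
    ENNReal.mul_ne_top (ENNReal.rpow_ne_top_of_ne_zero (by simp) (by simp)) hZ, fun τ => ?_⟩
  have hinj : Function.Injective fun i : ℕ => (i : ℤ) - ⌊τ⌋ := fun a b h => by
    simpa using h
  rw [← ENNReal.tsum_mul_left]
  refine le_trans (ENNReal.tsum_le_tsum fun i => ?_) (ENNReal.tsum_comp_le_tsum_of_injective hinj _)
  rw [← ENNReal.rpow_add _ _ (by simp) (by simp)]
  refine ENNReal.rpow_le_rpow_of_exponent_le (by norm_num) ?_
  push_cast
  have h1 : |(i : ℝ) - ⌊τ⌋| ≤ |i - τ| + 1 := by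
    have h2 : |τ - ⌊τ⌋| ≤ 1 := by
      rw [abs_le]
      constructor <;> linarith [Int.floor_le τ, Int.lt_floor_add_one τ]
    calc |(i : ℝ) - ⌊τ⌋| = |(i - τ) + (τ - ⌊τ⌋)| := by ring_nf
      _ ≤ |i - τ| + |τ - ⌊τ⌋| := abs_add_le _ _
      _ ≤ _ := by linarith
  nlinarith

lemma exists_eq_two_rpow {t : ℝ≥0∞} (h0 : t ≠ 0) (ht : t ≠ ∞) : ∃ x : ℝ, t = 2 ^ x := by
  have hpos := ENNReal.toReal_pos h0 ht
  refine ⟨Real.logb 2 t.toReal, ?_⟩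
  rw [← ENNReal.ofReal_toReal ht]
  nth_rewrite 1 [← Real.rpow_logb (b := 2) (by norm_num) (by norm_num) hpos]
  rw [← ENNReal.ofReal_rpow_of_pos (by norm_num), ENNReal.toReal_ofReal ENNReal.toReal_nonneg]
  simp

/-- The rising and the falling geometric sequence cross at a real index $\tau$, with common value
$t^{\beta/(\alpha+\beta)}$. On both sides of $\tau$ the minimum decays geometrically, at rate at
least $\min(\alpha,\beta)$. -/
lemma exists_tsum_min_le {α β : ℝ} (hα : 0 < α) (hβ : 0 < β) :
    ∃ C : ℝ≥0∞, C ≠ ∞ ∧ ∀ t : ℝ≥0∞, t ≠ 0 → t ≠ ∞ →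
      ∑' i : ℕ, min (t * 2 ^ (α * i)) ((2 : ℝ≥0∞) ^ (-β * i)) ≤ C * t ^ (β / (α + β)) := by
  obtain ⟨C, hC, h⟩ := exists_tsum_two_rpow_neg_abs_le (lt_min hα hβ)
  refine ⟨C, hC, fun t h0 ht => ?_⟩
  obtain ⟨x, rfl⟩ := exists_eq_two_rpow h0 ht
  have hs : 0 < α + β := by positivity
  refine le_trans ?_ (mul_le_mul_left (h (-x / (α + β))) _)
  rw [← ENNReal.tsum_mul_right]
  refine ENNReal.tsum_le_tsum fun i => ?_
  rw [← ENNReal.rpow_mul, ← ENNReal.rpow_add _ _ (by simp) (by simp),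
    ← ENNReal.rpow_add _ _ (by simp) (by simp)]
  set τ := -x / (α + β) with hτ
  have hx : x = -τ * (α + β) := by rw [hτ]; field_simp
  have hx' : x * (β / (α + β)) = -τ * β := by rw [hx]; field_simp
  rw [hx', hx]
  rcases le_total (i : ℝ) τ with hi | hi
  · refine (min_le_left _ _).trans (ENNReal.rpow_le_rpow_of_exponent_le (by norm_num) ?_)
    rw [abs_of_nonpos (by linarith)]
    nlinarith [mul_le_mul_of_nonneg_right (min_le_left α β) (sub_nonneg.2 hi)]
  · refine (min_le_right _ _).trans (ENNReal.rpow_le_rpow_of_exponent_le (by norm_num) ?_)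
    rw [abs_of_nonneg (by linarith)]
    nlinarith [mul_le_mul_of_nonneg_right (min_le_right α β) (sub_nonneg.2 hi)]

lemma sum_shell_mul_dyadicWeight (f : Lattice d → ℝ≥0∞) (s : ℝ) (i : ℕ) :
    ∑ n ∈ shell d i, f n * dyadicWeight s n = (∑ n ∈ shell d i, f n) * 2 ^ (s * i) := by
  rw [Finset.sum_mul]
  refine Finset.sum_congr rfl fun n hn => ?_
  rw [dyadicWeight, mem_shell.1 hn]

lemma card_shell_cast_le (d i : ℕ) :
    ((shell d i).card : ℝ≥0∞) ≤ 4 ^ d * 2 ^ ((d : ℝ) * i) := by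
  have h : ((shell d i).card : ℝ≥0∞) ≤ ((4 ^ d * (2 ^ i) ^ d : ℕ) : ℝ≥0∞) :=
    Nat.cast_le.2 (card_shell_le d i)
  refine h.trans (le_of_eq ?_)
  push_cast
  rw [mul_comm (d : ℝ), ENNReal.rpow_mul, ENNReal.rpow_natCast, ENNReal.rpow_natCast]

lemma le_card_shell_cast (hd : 1 ≤ d) (i : ℕ) :
    (2 : ℝ≥0∞) ^ ((d : ℝ) * i) ≤ (shell d i).card := by
  have h : (((2 ^ i) ^ d : ℕ) : ℝ≥0∞) ≤ (shell d i).card := Nat.cast_le.2 (le_card_shell hd i)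
  refine le_trans (le_of_eq ?_) h
  push_cast
  rw [mul_comm (d : ℝ), ENNReal.rpow_mul, ENNReal.rpow_natCast, ENNReal.rpow_natCast]

lemma tsum_dyadicWeight_ne_top {s : ℝ} (hs : s < -d) :
    ∑' n : Lattice d, dyadicWeight s n ≠ ∞ := by
  rw [tsum_eq_tsum_shell]
  have h : 0 < -(d + s) := by linarith
  refine ne_top_of_le_ne_top (ENNReal.mul_ne_top (a := 4 ^ d) (by simp) (tsum_two_rpow_neg h)) ?_
  rw [← ENNReal.tsum_mul_left]
  refine ENNReal.tsum_le_tsum fun i => ?_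
  have := sum_shell_mul_dyadicWeight (fun _ : Lattice d => 1) s i
  simp only [one_mul, Finset.sum_const, nsmul_eq_mul, mul_one] at this
  rw [this]
  refine (mul_le_mul_left (card_shell_cast_le d i) _).trans (le_of_eq ?_)
  rw [mul_assoc, ← ENNReal.rpow_add _ _ (by simp) (by simp)]
  ring_nf

end

/-! ### The discrete Hardy–Littlewood–Sobolev inequality. -/

section

variable {d : ℕ}

/-- A sequence with `‖c‖_{1/v} ≤ 1` and `‖c‖_∞ ≤ t` paired with a power kernel. -/
lemma exists_tsum_mul_dyadicWeight_le (hd : 1 ≤ d) {u v : ℝ} (hu1 : u < 1) (hv : 0 < v)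
    (hv1 : v < 1) (huv : 1 < u + v) :
    ∃ C : ℝ≥0∞, C ≠ ∞ ∧ ∀ t : ℝ≥0∞, t ≠ 0 → t ≠ ∞ → ∀ c : Lattice d → ℝ≥0∞, (∀ n, c n ≤ t) →
      ∑' n, c n ^ (1 / v) ≤ 1 →
      ∑' n, c n * dyadicWeight (-(d * (2 - u - v))) n ≤ C * t ^ ((1 - u) / v) := by
  have hd' : (0 : ℝ) < d := by exact_mod_cast hd
  -- On shell $i$, times the kernel, the bound $c\le t$ gives $t\,2^{d(u+v-1)i}$ and Hölder gives
  -- $2^{-d(1-u)i}$, both up to $4^d$.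
  obtain ⟨C, hC, h⟩ := exists_tsum_min_le (α := d * (u + v - 1)) (β := d * (1 - u))
    (mul_pos hd' (by linarith)) (mul_pos hd' (by linarith))
  refine ⟨4 ^ d * C, ENNReal.mul_ne_top (by simp) hC, fun t h0 ht c hct hc => ?_⟩
  have e : d * (1 - u) / (d * (u + v - 1) + d * (1 - u)) = (1 - u) / v := by
    rw [← mul_add, mul_div_mul_left _ _ hd'.ne']
    ring_nf
  have h' := h t h0 ht
  rw [e] at h'
  rw [mul_assoc]
  refine le_trans ?_ (mul_le_mul_right h' _)
  rw [tsum_eq_tsum_shell, ← ENNReal.tsum_mul_left]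
  refine ENNReal.tsum_le_tsum fun i => ?_
  rw [sum_shell_mul_dyadicWeight]
  have hcard := card_shell_cast_le d i
  have h1 : ∑ n ∈ shell d i, c n ≤ 4 ^ d * (t * 2 ^ ((d : ℝ) * i)) := by
    calc ∑ n ∈ shell d i, c n ≤ ∑ n ∈ shell d i, t := Finset.sum_le_sum fun n _ => hct n
      _ = (shell d i).card * t := by rw [Finset.sum_const, nsmul_eq_mul]
      _ ≤ 4 ^ d * 2 ^ ((d : ℝ) * i) * t := by gcongr
      _ = _ := by ring
  have h2 : ∑ n ∈ shell d i, c n ≤ 4 ^ d * 2 ^ ((d : ℝ) * (1 - v) * i) := by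
    have h3 := ENNReal.rpow_sum_le_const_mul_sum_rpow (shell d i) c
      (p := 1 / v) ((le_div_iff₀ hv).2 (by linarith))
    have h4 : ∑ n ∈ shell d i, c n ^ (1 / v) ≤ 1 := (ENNReal.sum_le_tsum _).trans hc
    have h5 := ENNReal.rpow_le_rpow (h3.trans (mul_le_mul_right h4 _)) hv.le
    rw [← ENNReal.rpow_mul, one_div_mul_cancel hv.ne', ENNReal.rpow_one, mul_one,
      ← ENNReal.rpow_mul] at h5
    have e2 : (1 / v - 1) * v = 1 - v := by field_simp
    rw [e2] at h5
    refine h5.trans ((ENNReal.rpow_le_rpow hcard (by linarith)).trans ?_)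
    rw [ENNReal.mul_rpow_of_nonneg _ _ (by linarith), ← ENNReal.rpow_mul]
    refine mul_le_mul' ?_ (le_of_eq (by ring_nf))
    calc ((4 : ℝ≥0∞) ^ d) ^ (1 - v) ≤ ((4 : ℝ≥0∞) ^ d) ^ (1 : ℝ) :=
          ENNReal.rpow_le_rpow_of_exponent_le (one_le_pow₀ (by norm_num)) (by linarith)
      _ = _ := ENNReal.rpow_one _
  rw [mul_min]
  refine le_min ?_ ?_
  · refine (mul_le_mul_left h1 _).trans (le_of_eq ?_)
    rw [mul_assoc, mul_assoc, ← ENNReal.rpow_add _ _ (by simp) (by simp)]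
    ring_nf
  · refine (mul_le_mul_left h2 _).trans (le_of_eq ?_)
    rw [mul_assoc, ← ENNReal.rpow_add _ _ (by simp) (by simp)]
    ring_nf

/-- Half of the bilinear form. For fixed $k$ the surviving $c_j$ are at most $t=b_k^{v/u}$, and
$b_k\,t^{(1-u)/v}=b_k^{1/u}$ is summable in $k$. -/
lemma exists_tsum_truncated_le (hd : 1 ≤ d) {u v : ℝ} (hu : 0 < u) (hu1 : u < 1) (hv : 0 < v)
    (hv1 : v < 1) (huv : 1 < u + v) :
    ∃ C : ℝ≥0∞, C ≠ ∞ ∧ ∀ b c : Lattice d → ℝ≥0∞, ∑' n, b n ^ (1 / u) ≤ 1 →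
      ∑' n, c n ^ (1 / v) ≤ 1 →
      ∑' k, ∑' j, b k * (open Classical in if c j ^ (1 / v) ≤ b k ^ (1 / u) then c j else 0)
        * dyadicWeight (-(d * (2 - u - v))) (k - j) ≤ C := by
  classical
  obtain ⟨C, hC, h⟩ := exists_tsum_mul_dyadicWeight_le hd hu1 hv hv1 huv
  refine ⟨C, hC, fun b c hb hc => ?_⟩
  calc _ ≤ ∑' k, C * b k ^ (1 / u) := ENNReal.tsum_le_tsum fun k => ?_
    _ = C * ∑' k, b k ^ (1 / u) := ENNReal.tsum_mul_left
    _ ≤ C * 1 := by gcongr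
    _ = C := mul_one C
  simp only [mul_assoc]
  rw [ENNReal.tsum_mul_left]
  rcases eq_or_ne (b k) 0 with h0 | h0
  · simp [h0]
  have hbt : b k ≠ ∞ := by
    intro ht
    have := (ENNReal.le_tsum k).trans hb
    rw [ht, ENNReal.top_rpow_of_pos (by positivity)] at this
    exact absurd this (by simp)
  have ht0 : b k ^ (v / u) ≠ 0 := by simp [ENNReal.rpow_eq_zero_iff, h0, hbt]
  have htt : b k ^ (v / u) ≠ ∞ := ENNReal.rpow_ne_top_of_ne_zero h0 hbt
  have h1 := h _ ht0 htt
    (fun n => if c (k - n) ^ (1 / v) ≤ b k ^ (1 / u) then c (k - n) else 0) (fun n => ?_) ?_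
  · rw [← (Equiv.subLeft k).tsum_eq]
    simp only [Equiv.subLeft_apply, sub_sub_cancel]
    refine (mul_le_mul_right h1 _).trans (le_of_eq ?_)
    rw [← ENNReal.rpow_mul]
    nth_rewrite 1 [← ENNReal.rpow_one (b k)]
    rw [mul_left_comm, ← ENNReal.rpow_add _ _ h0 hbt]
    congr 2
    field_simp
    ring
  · split_ifs with hn
    · have := ENNReal.rpow_le_rpow hn hv.le
      rwa [← ENNReal.rpow_mul, ← ENNReal.rpow_mul, one_div_mul_cancel hv.ne', ENNReal.rpow_one,
        one_div_mul_eq_div] at this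
    · exact zero_le
  · refine le_trans ?_ hc
    rw [← (Equiv.subLeft k).tsum_eq fun n => c n ^ (1 / v)]
    simp only [Equiv.subLeft_apply]
    refine ENNReal.tsum_le_tsum fun n => ENNReal.rpow_le_rpow ?_ (by positivity)
    split_ifs
    · exact le_rfl
    · exact zero_le

/-- The Hardy–Littlewood–Sobolev inequality on the lattice, for normalised sequences. -/
lemma exists_hardyLittlewoodSobolev_normalised (hd : 1 ≤ d) {u v : ℝ} (hu : 0 < u) (hu1 : u < 1)
    (hv : 0 < v) (hv1 : v < 1) (huv : 1 < u + v) :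
    ∃ C : ℝ≥0∞, C ≠ ∞ ∧ ∀ b c : Lattice d → ℝ≥0∞, ∑' n, b n ^ (1 / u) ≤ 1 →
      ∑' n, c n ^ (1 / v) ≤ 1 →
      ∑' k, ∑' j, b k * c j * dyadicWeight (-(d * (2 - u - v))) (k - j) ≤ C := by
  classical
  obtain ⟨C₁, hC₁, h₁⟩ := exists_tsum_truncated_le hd hu hu1 hv hv1 huv
  obtain ⟨C₂, hC₂, h₂⟩ := exists_tsum_truncated_le hd hv hv1 hu hu1 (by linarith)
  refine ⟨C₁ + C₂, ENNReal.add_ne_top.2 ⟨hC₁, hC₂⟩, fun b c hb hc => ?_⟩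
  refine le_trans ?_ (add_le_add (h₁ b c hb hc) (h₂ c b hc hb))
  rw [ENNReal.tsum_comm (f := fun k j => c k * _ * _), ← ENNReal.tsum_add]
  refine ENNReal.tsum_le_tsum fun k => ?_
  rw [← ENNReal.tsum_add]
  refine ENNReal.tsum_le_tsum fun j => ?_
  rw [← neg_sub k j, dyadicWeight_neg_arg, sub_right_comm 2 v u, ← add_mul]
  refine mul_le_mul_left ?_ _
  -- Each pair $(k,j)$ survives in one of the two truncated forms, the second having $b$ and $c$
  -- interchanged.
  rcases le_total (c j ^ (1 / v)) (b k ^ (1 / u)) with hh | hh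
  · rw [if_pos hh]
    exact le_self_add
  · rw [if_pos hh, mul_comm]
    exact le_add_self

/-- The Hardy–Littlewood–Sobolev inequality on the lattice. -/
lemma exists_hardyLittlewoodSobolev (hd : 1 ≤ d) {u v : ℝ} (hu : 0 < u) (hu1 : u < 1) (hv : 0 < v)
    (hv1 : v < 1) (huv : 1 < u + v) :
    ∃ C : ℝ≥0∞, C ≠ ∞ ∧ ∀ b c : Lattice d → ℝ≥0∞,
      ∑' k, ∑' j, b k * c j * dyadicWeight (-(d * (2 - u - v))) (k - j)
        ≤ C * ((∑' n, b n ^ (1 / u)) ^ u * (∑' n, c n ^ (1 / v)) ^ v) := by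
  obtain ⟨C, hC, h⟩ := exists_hardyLittlewoodSobolev_normalised hd hu hu1 hv hv1 huv
  -- A nonzero constant makes the right side infinite when one norm is infinite and the other
  -- nonzero.
  refine ⟨C + 1, ENNReal.add_ne_top.2 ⟨hC, by simp⟩, fun b c => ?_⟩
  have hz : ∀ {w : ℝ}, 0 < w → ∀ f : Lattice d → ℝ≥0∞, (∑' n, f n ^ (1 / w)) ^ w = 0 →
      ∀ n, f n = 0 := by
    intro w hw f hf n
    rw [ENNReal.rpow_eq_zero_iff_of_pos hw, ENNReal.tsum_eq_zero] at hf
    exact (ENNReal.rpow_eq_zero_iff_of_pos (by positivity)).1 (hf n)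
  have hn : ∀ {w : ℝ}, 0 < w → ∀ f : Lattice d → ℝ≥0∞, (∑' n, f n ^ (1 / w)) ^ w ≠ 0 →
      (∑' n, f n ^ (1 / w)) ^ w ≠ ∞ →
      ∑' n, (((∑' n, f n ^ (1 / w)) ^ w)⁻¹ * f n) ^ (1 / w) ≤ 1 := by
    intro w hw f h0 ht
    simp only [ENNReal.mul_rpow_of_nonneg _ _ (one_div_pos.2 hw).le, ENNReal.tsum_mul_left]
    rw [ENNReal.inv_rpow, ← ENNReal.rpow_mul, mul_one_div_cancel hw.ne', ENNReal.rpow_one]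
    exact ENNReal.inv_mul_le_one _
  set M := (∑' n, b n ^ (1 / u)) ^ u with hM
  set N := (∑' n, c n ^ (1 / v)) ^ v with hN
  rcases eq_or_ne M 0 with hM0 | hM0
  · simp [hz hu b hM0]
  rcases eq_or_ne N 0 with hN0 | hN0
  · simp [hz hv c hN0]
  rcases eq_or_ne M ∞ with hMt | hMt
  · rw [hMt, ENNReal.top_mul hN0, ENNReal.mul_top (by simp)]
    exact le_top
  rcases eq_or_ne N ∞ with hNt | hNt
  · rw [hNt, ENNReal.mul_top hM0, ENNReal.mul_top (by simp)]
    exact le_top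
  have h1 := h _ _ (hn hu b hM0 hMt) (hn hv c hN0 hNt)
  rw [← hM, ← hN] at h1
  calc ∑' k, ∑' j, b k * c j * dyadicWeight (-(d * (2 - u - v))) (k - j)
      = (M * N) * ∑' k, ∑' j, M⁻¹ * b k * (N⁻¹ * c j)
          * dyadicWeight (-(d * (2 - u - v))) (k - j) := by
        simp only [← ENNReal.tsum_mul_left]
        refine tsum_congr fun k => tsum_congr fun j => ?_
        calc _ = (M * M⁻¹) * (N * N⁻¹) * (b k * c j * dyadicWeight (-(d * (2 - u - v))) (k - j)) := by
              rw [ENNReal.mul_inv_cancel hM0 hMt, ENNReal.mul_inv_cancel hN0 hNt, one_mul, one_mul]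
          _ = _ := by ring
    _ ≤ (M * N) * C := by gcongr
    _ ≤ (M * N) * (C + 1) := by gcongr; exact le_self_add
    _ = _ := mul_comm _ _

end

/-! ### Sufficiency: embeddings of mixed norm spaces. -/

section

variable {d : ℕ}

/-- The endpoint estimate for sums, obtained from the Hardy–Littlewood–Sobolev inequality by
duality; `a₁`, `a₂`, `κ` are reciprocals of exponents. -/
lemma exists_tsum_tsum_le_of_pairing (hd : 1 ≤ d) {a₁ a₂ κ : ℝ} (h2 : 0 < a₂) (h21 : a₂ < a₁)
    (h1 : a₁ < 1) (hκ : 0 ≤ κ) (hκ2 : κ < a₂) :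
    ∃ K : ℝ≥0∞, K ≠ ∞ ∧ ∀ (F : Lattice d → Lattice d → ℝ≥0∞) (c : Lattice d → ℝ≥0∞),
      (∀ (b : Lattice d → ℝ≥0∞) (j : Lattice d), ∑' k, F j k * b k ≤ c j *
        (∑' k, b k ^ (1 / (1 - κ)) *
          dyadicWeight (-(d * (1 - a₁ + a₂ - κ) / (1 - κ))) (k - j)) ^ (1 - κ)) →
      (∑' k, (∑' j, F j k) ^ (1 / a₂)) ^ a₂ ≤ K * (∑' j, c j ^ (1 / a₁)) ^ a₁ := by
  have hσ : 0 < 1 - κ := by linarith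
  have ha1 : 0 < a₁ := by linarith
  -- The conditions $u<1$, $v<1$ and $u+v>1$ say $\kappa<a_2$, $a_1<1$ and $a_2<a_1$.
  set u := (1 - a₂) / (1 - κ) with hu
  set v := (a₁ - κ) / (1 - κ) with hv
  have hv0 : 0 < v := div_pos (by linarith) hσ
  have huσ : u * (1 - κ) = 1 - a₂ := by rw [hu]; field_simp
  have hvσ : v * (1 - κ) = a₁ - κ := by rw [hv]; field_simp
  obtain ⟨K, hK, h⟩ := exists_hardyLittlewoodSobolev hd (u := u) (v := v)
    (div_pos (by linarith) hσ) ((div_lt_one hσ).2 (by linarith)) hv0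
    ((div_lt_one hσ).2 (by linarith)) (by rw [hu, hv, ← add_div, one_lt_div hσ]; linarith)
  have hS : (d : ℝ) * (2 - u - v) = d * (1 - a₁ + a₂ - κ) / (1 - κ) := by
    rw [hu, hv]; field_simp; ring
  rw [hS] at h
  refine ⟨K ^ (1 - κ), ENNReal.rpow_ne_top_of_nonneg hσ.le hK, fun F c hF => ?_⟩
  refine tsum_rpow_le_of_dual h2 (by linarith) fun b => ?_
  set D : Lattice d → ℝ≥0∞ := fun j => ∑' k, b k ^ (1 / (1 - κ)) *
    dyadicWeight (-(d * (1 - a₁ + a₂ - κ) / (1 - κ))) (k - j) with hD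
  set N := ∑' j, c j ^ (1 / a₁) with hN
  calc ∑' k, (∑' j, F j k) * b k = ∑' j, ∑' k, F j k * b k := by
        simp only [← ENNReal.tsum_mul_right]
        exact ENNReal.tsum_comm
    _ ≤ ∑' j, c j * D j ^ (1 - κ) := ENNReal.tsum_le_tsum fun j => hF b j
    -- Splitting $c_j$ this way, Hölder in $j$ leaves the Hardy–Littlewood–Sobolev form of
    -- $b^{1/(1-\kappa)}$ and $c^{v/a_1}$.
    _ = ∑' j, (c j ^ (1 / a₁)) ^ κ * (c j ^ (v / a₁) * D j) ^ (1 - κ) := by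
        refine tsum_congr fun j => ?_
        rw [ENNReal.mul_rpow_of_nonneg _ _ hσ.le, ← mul_assoc, ← ENNReal.rpow_mul,
          ← ENNReal.rpow_mul, ← ENNReal.rpow_add_of_nonneg _ _ (by positivity) (by positivity)]
        have : 1 / a₁ * κ + v / a₁ * (1 - κ) = 1 := by
          rw [div_mul_eq_mul_div, div_mul_eq_mul_div, hvσ]
          field_simp
          ring
        rw [this, ENNReal.rpow_one]
    _ ≤ N ^ κ * (∑' j, c j ^ (v / a₁) * D j) ^ (1 - κ) :=
        tsum_rpow_mul_rpow_le _ _ hκ hσ.le (by ring)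
    _ ≤ N ^ κ * (K * ((∑' k, b k ^ (1 / (1 - a₂))) ^ u * N ^ v)) ^ (1 - κ) := by
        refine mul_le_mul_right (ENNReal.rpow_le_rpow ?_ hσ.le) _
        have h' := h (fun k => b k ^ (1 / (1 - κ))) (fun j => c j ^ (v / a₁))
        simp only [← ENNReal.rpow_mul] at h'
        have e1 : 1 / (1 - κ) * (1 / u) = 1 / (1 - a₂) := by
          rw [← huσ, one_div_mul_one_div, mul_comm]
        have e2 : v / a₁ * (1 / v) = 1 / a₁ := by field_simp
        rw [e1, e2] at h'
        refine le_trans (le_of_eq ?_) h'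
        rw [ENNReal.tsum_comm]
        refine tsum_congr fun j => ?_
        rw [hD, ← ENNReal.tsum_mul_left]
        exact tsum_congr fun k => by ring
    _ = _ := by
        rw [ENNReal.mul_rpow_of_nonneg _ _ hσ.le, ENNReal.mul_rpow_of_nonneg _ _ hσ.le,
          ← ENNReal.rpow_mul, ← ENNReal.rpow_mul, huσ, hvσ]
        have : N ^ a₁ = N ^ κ * N ^ (a₁ - κ) := by
          rw [← ENNReal.rpow_add_of_nonneg _ _ hκ (by linarith)]
          ring_nf
        rw [this]
        ring

lemma toReal_one_div_le_iff {p q : ℝ≥0∞} (hp : 0 < p) (hq : 0 < q) :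
    (1 / p).toReal ≤ (1 / q).toReal ↔ q ≤ p := by
  rw [ENNReal.toReal_le_toReal (by simp [hp.ne']) (by simp [hq.ne'])]
  simp

/-- The endpoint embedding between mixed norm spaces. -/
lemma exists_lqNorm_lqNorm_le_endpoint (hd : 1 ≤ d) {p₁ p₂ q₁ q₂ : ℝ≥0∞} (hq₂ : 0 < q₂)
    (h21 : q₂ < p₁) (h12 : p₁ < p₂) (h22 : p₂ < q₁) {s : ℝ}
    (hs : s = d * ((1 / q₂).toReal - (1 / p₁).toReal + (1 / p₂).toReal - (1 / q₁).toReal)) :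
    ∃ C : ℝ≥0∞, C ≠ ∞ ∧ ∀ G : Lattice d → Lattice d → ℝ≥0∞,
      lqNorm p₂ (fun k => lqNorm q₂ fun j => G j k) ≤
        C * lqNorm p₁ fun j => lqNorm q₁ fun k => G j k * dyadicWeight s (k - j) := by
  have hp₁ := hq₂.trans h21
  have hp₂ := hp₁.trans h12
  have hq₁ := hp₂.trans h22
  have hp₂t : p₂ ≠ ∞ := h22.ne_top
  have hp₁t : p₁ ≠ ∞ := h12.ne_top
  have hq₂t : q₂ ≠ ∞ := h21.ne_top
  set r := q₂.toReal with hr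
  have hr0 : 0 < r := ENNReal.toReal_pos hq₂.ne' hq₂t
  have hP1 : 0 < p₁.toReal := ENNReal.toReal_pos hp₁.ne' hp₁t
  have hP2 : 0 < p₂.toReal := ENNReal.toReal_pos hp₂.ne' hp₂t
  have l1 : r < p₁.toReal := (ENNReal.toReal_lt_toReal hq₂t hp₁t).2 h21
  have l2 : p₁.toReal < p₂.toReal := (ENNReal.toReal_lt_toReal hp₁t hp₂t).2 h12
  have l3 : (1 / q₁).toReal < 1 / p₂.toReal := by
    have := not_le.1 (mt (toReal_one_div_le_iff hp₂ hq₁).1 (not_le.2 h22))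
    simpa using this
  set κ := r * (1 / q₁).toReal with hκ
  have hκ0 : 0 ≤ κ := by positivity
  have hκ2 : κ < r / p₂.toReal := by
    rw [hκ, div_eq_mul_one_div r]
    exact mul_lt_mul_of_pos_left l3 hr0
  have ha21 : r / p₂.toReal < r / p₁.toReal := by gcongr
  have ha1 : r / p₁.toReal < 1 := (div_lt_one hP1).2 l1
  have hσ : 0 < 1 - κ := by linarith
  -- Taking powers $r=q_2$ turns the inner norm into a plain sum, so all exponents are divided by
  -- $r$.
  obtain ⟨K, hK, h⟩ := exists_tsum_tsum_le_of_pairing hd (a₁ := r / p₁.toReal)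
    (a₂ := r / p₂.toReal) (κ := κ) (by positivity) ha21 ha1 hκ0 hκ2
  have hS : d * (1 - r / p₁.toReal + r / p₂.toReal - κ) = s * r := by
    rw [hs, hκ]
    simp only [one_div, ENNReal.toReal_inv]
    rw [← hr]
    field_simp
  rw [hS] at h
  refine ⟨K ^ (1 / r), ENNReal.rpow_ne_top_of_nonneg (by positivity) hK, fun G => ?_⟩
  set c : Lattice d → ℝ≥0∞ := fun j => lqNorm q₁ fun k => G j k * dyadicWeight s (k - j) with hc
  have hG : ∀ j k, G j k ^ r =
      (G j k * dyadicWeight s (k - j)) ^ r * dyadicWeight (-(s * r)) (k - j) := by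
    intro j k
    rw [ENNReal.mul_rpow_of_nonneg _ _ hr0.le, dyadicWeight_rpow, mul_assoc, dyadicWeight_mul,
      add_neg_cancel, dyadicWeight_zero, mul_one]
  have h' := h (fun j k => G j k ^ r) (fun j => c j ^ r) ?_
  · simp only [← ENNReal.rpow_mul] at h'
    have e1 : r * (1 / (r / p₁.toReal)) = p₁.toReal := by field_simp
    have e2 : 1 / (r / p₂.toReal) = 1 / r * p₂.toReal := by field_simp
    rw [e1, e2] at h'
    have h'' := ENNReal.rpow_le_rpow h' (z := 1 / r) (by positivity)
    rw [ENNReal.mul_rpow_of_nonneg _ _ (by positivity), ← ENNReal.rpow_mul, ← ENNReal.rpow_mul]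
      at h''
    have e3 : r / p₁.toReal * (1 / r) = 1 / p₁.toReal := by field_simp
    have e4 : r / p₂.toReal * (1 / r) = 1 / p₂.toReal := by field_simp
    rw [e3, e4] at h''
    simp only [lqNorm_of_ne_top hp₁t, lqNorm_of_ne_top hp₂t, lqNorm_of_ne_top hq₂t,
      ← ENNReal.rpow_mul]
    exact h''
  · intro b j
    have hw : ∀ k, (b k * dyadicWeight (-(s * r)) (k - j)) ^ (1 / (1 - κ)) =
        b k ^ (1 / (1 - κ)) * dyadicWeight (-(s * r / (1 - κ))) (k - j) := fun k => by
      rw [ENNReal.mul_rpow_of_nonneg _ _ (by positivity), dyadicWeight_rpow]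
      ring_nf
    -- Here $\kappa=0$, and Hölder in $k$ becomes a supremum bound.
    by_cases hq₁t : q₁ = ∞
    · have hκz : κ = 0 := by rw [hκ, hq₁t]; simp
      rw [hκz] at hw ⊢
      simp only [← hw]
      simp only [sub_zero, div_one, ENNReal.rpow_one]
      rw [← ENNReal.tsum_mul_left]
      refine ENNReal.tsum_le_tsum fun k => ?_
      rw [hG, mul_assoc, mul_comm (dyadicWeight _ _)]
      refine mul_le_mul_left (ENNReal.rpow_le_rpow ?_ hr0.le) _
      exact le_lqNorm hq₁ (fun k => G j k * dyadicWeight s (k - j)) k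
    · have hQ : 0 < q₁.toReal := ENNReal.toReal_pos hq₁.ne' hq₁t
      have hκQ : κ = r / q₁.toReal := by
        rw [hκ, one_div, ENNReal.toReal_inv, div_eq_mul_inv]
      simp only [← hw]
      have hcj : c j ^ r = (∑' k, (G j k * dyadicWeight s (k - j)) ^ q₁.toReal) ^ κ := by
        rw [← lqNorm_rpow hq₁ hq₁t, ← ENNReal.rpow_mul, hκQ]
        congr 1
        field_simp
      rw [hcj]
      refine le_trans (le_of_eq ?_) (tsum_rpow_mul_rpow_le _ _ hκ0 hσ.le (by ring))
      refine tsum_congr fun k => ?_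
      rw [← ENNReal.rpow_mul, ← ENNReal.rpow_mul, one_div_mul_cancel hσ.ne', ENNReal.rpow_one, hG,
        hκQ, mul_div_cancel₀ _ hQ.ne', mul_assoc, mul_comm (dyadicWeight _ _)]

/-- Embeddings between weighted sequence spaces. -/
lemma exists_lqNorm_le_lqNorm_mul_dyadicWeight {p q : ℝ≥0∞} (hp : 0 < p) (hq : 0 < q) {s : ℝ}
    (hs : 0 ≤ s) (h : q ≤ p ∨ d * ((1 / p).toReal - (1 / q).toReal) < s) :
    ∃ C : ℝ≥0∞, C ≠ ∞ ∧ ∀ (g : Lattice d → ℝ≥0∞) (m : Lattice d),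
      lqNorm p g ≤ C * lqNorm q fun n => g n * dyadicWeight s (n - m) := by
  suffices ∃ C : ℝ≥0∞, C ≠ ∞ ∧ ∀ g : Lattice d → ℝ≥0∞,
      lqNorm p g ≤ C * lqNorm q fun n => g n * dyadicWeight s n by
    obtain ⟨C, hC, h⟩ := this
    refine ⟨C, hC, fun g m => ?_⟩
    have := h fun n => g (n + m)
    rw [← lqNorm_comp_equiv p (Equiv.addRight m), ← lqNorm_comp_equiv q (Equiv.addRight m)]
    simpa using this
  by_cases hqp : q ≤ p
  · refine ⟨1, by simp, fun g => ?_⟩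
    rw [one_mul]
    refine (lqNorm_anti hq hqp g).trans (lqNorm_mono q fun n => ?_)
    calc g n = g n * dyadicWeight 0 n := by simp
      _ ≤ _ := by gcongr; exact dyadicWeight_mono hs n
  have hs' := h.resolve_left hqp
  rw [not_le] at hqp
  have hpt : p ≠ ∞ := hqp.ne_top
  have hP : 0 < p.toReal := ENNReal.toReal_pos hp.ne' hpt
  have hg : ∀ (g : Lattice d → ℝ≥0∞) n,
      g n = g n * dyadicWeight s n * dyadicWeight (-s) n := by
    intro g n
    rw [mul_assoc, dyadicWeight_mul, add_neg_cancel, dyadicWeight_zero, mul_one]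
  by_cases hqt : q = ∞
  · refine ⟨lqNorm p fun n : Lattice d => dyadicWeight (-s) n, ?_, fun g => ?_⟩
    · rw [lqNorm_of_ne_top hpt]
      refine ENNReal.rpow_ne_top_of_nonneg (by positivity) ?_
      simp only [dyadicWeight_rpow]
      refine tsum_dyadicWeight_ne_top ?_
      rw [hqt] at hs'
      simp only [one_div, ENNReal.toReal_inv, ENNReal.inv_top, ENNReal.toReal_zero, sub_zero] at hs'
      rw [← div_eq_mul_inv, div_lt_iff₀ hP] at hs'
      linarith
    · rw [mul_comm, ← lqNorm_const_mul hp]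
      refine lqNorm_mono p fun n => ?_
      rw [hg g n]
      exact mul_le_mul_left (le_lqNorm hq (fun n => g n * dyadicWeight s n) n) _
  · have hQ : 0 < q.toReal := ENNReal.toReal_pos hq.ne' hqt
    have hPQ : p.toReal < q.toReal := (ENNReal.toReal_lt_toReal hpt hqt).2 hqp
    set κ := p.toReal / q.toReal with hκ
    have hκ0 : 0 < κ := by positivity
    have hσ : 0 < 1 - κ := by rw [hκ, sub_pos, div_lt_one hQ]; exact hPQ
    refine ⟨((∑' n : Lattice d, dyadicWeight (-(s * p.toReal / (1 - κ))) n) ^ (1 - κ))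
      ^ (1 / p.toReal), ?_, fun g => ?_⟩
    · refine ENNReal.rpow_ne_top_of_nonneg (by positivity) (ENNReal.rpow_ne_top_of_nonneg hσ.le
        (tsum_dyadicWeight_ne_top ?_))
      -- The weight left over from Hölder is summable exactly when $sp/(1-p/q)>d$, that is
      -- $s>d(1/p-1/q)$.
      rw [neg_lt_neg_iff, lt_div_iff₀ hσ]
      simp only [one_div, ENNReal.toReal_inv] at hs'
      have : (d : ℝ) * (1 - κ) = d * (p.toReal⁻¹ - q.toReal⁻¹) * p.toReal := by
        rw [hκ]; field_simp
      rw [this]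
      gcongr
    · rw [lqNorm_of_ne_top hpt, lqNorm_of_ne_top hqt]
      have e : 1 / q.toReal = κ * (1 / p.toReal) := by rw [hκ]; field_simp
      rw [e, ENNReal.rpow_mul, ← ENNReal.mul_rpow_of_nonneg _ _ (by positivity)]
      refine ENNReal.rpow_le_rpow ?_ (by positivity)
      rw [mul_comm]
      refine le_trans (le_of_eq ?_) (tsum_rpow_mul_rpow_le _ _ hκ0.le hσ.le (by ring))
      refine tsum_congr fun n => ?_
      rw [dyadicWeight_rpow, ← ENNReal.rpow_mul, hκ, mul_div_cancel₀ _ hQ.ne', ← hκ, ← neg_div,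
        div_mul_cancel₀ _ hσ.ne', ← neg_mul, ← dyadicWeight_rpow,
        ← ENNReal.mul_rpow_of_nonneg _ _ hP.le, ← hg g n]

/-- The embedding between mixed norm spaces, for a weight that splits. -/
lemma exists_lqNorm_lqNorm_le_of_add {p₁ p₂ q₁ q₂ : ℝ≥0∞} (hp₁ : 0 < p₁) (hq₁ : 0 < q₁)
    (hq₂ : 0 < q₂) (h12 : p₁ ≤ p₂) {s₁ s₂ : ℝ} (hs₁ : 0 ≤ s₁) (hs₂ : 0 ≤ s₂)
    (h₁ : p₁ ≤ q₂ ∨ d * ((1 / q₂).toReal - (1 / p₁).toReal) < s₁)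
    (h₂ : q₁ ≤ p₂ ∨ d * ((1 / p₂).toReal - (1 / q₁).toReal) < s₂) :
    ∃ C : ℝ≥0∞, C ≠ ∞ ∧ ∀ G : Lattice d → Lattice d → ℝ≥0∞,
      lqNorm p₂ (fun k => lqNorm q₂ fun j => G j k) ≤
        C * lqNorm p₁ fun j => lqNorm q₁ fun k => G j k * dyadicWeight (s₁ + s₂) (k - j) := by
  have hp₂ := hp₁.trans_le h12
  obtain ⟨C₁, hC₁, h₁⟩ := exists_lqNorm_le_lqNorm_mul_dyadicWeight hq₂ hp₁ hs₁ h₁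
  obtain ⟨C₂, hC₂, h₂⟩ := exists_lqNorm_le_lqNorm_mul_dyadicWeight hp₂ hq₁ hs₂ h₂
  refine ⟨C₁ * C₂, ENNReal.mul_ne_top hC₁ hC₂, fun G => ?_⟩
  calc lqNorm p₂ (fun k => lqNorm q₂ fun j => G j k)
      ≤ lqNorm p₂ (fun k => C₁ * lqNorm p₁ fun j => G j k * dyadicWeight s₁ (k - j)) := by
        refine lqNorm_mono _ fun k => (h₁ _ k).trans (le_of_eq ?_)
        simp only [← neg_sub k, dyadicWeight_neg_arg]
    _ = C₁ * lqNorm p₂ (fun k => lqNorm p₁ fun j => G j k * dyadicWeight s₁ (k - j)) :=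
        lqNorm_const_mul hp₂ _ _
    _ ≤ C₁ * lqNorm p₁ (fun j => lqNorm p₂ fun k => G j k * dyadicWeight s₁ (k - j)) := by
        gcongr
        exact lqNorm_lqNorm_le hp₁ h12 _
    _ ≤ C₁ * lqNorm p₁ (fun j => C₂ * lqNorm q₁ fun k =>
          G j k * dyadicWeight s₁ (k - j) * dyadicWeight s₂ (k - j)) := by
        gcongr
        exact lqNorm_mono _ fun j => h₂ _ j
    _ = _ := by
        rw [lqNorm_const_mul hp₁, mul_assoc]
        simp only [mul_assoc, dyadicWeight_mul]

/-- The embedding between mixed norm spaces, in all admissible cases. -/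
lemma exists_lqNorm_lqNorm_le (hd : 1 ≤ d) {p₁ p₂ q₁ q₂ : ℝ≥0∞} (hp₁ : 0 < p₁) (hp₂ : 0 < p₂)
    (hq₁ : 0 < q₁) (hq₂ : 0 < q₂) (h12 : p₁ ≤ p₂) {s A B : ℝ}
    (hA : A = d * ((1 / p₂).toReal - (1 / q₁).toReal))
    (hB : B = d * ((1 / q₂).toReal - (1 / p₁).toReal))
    (hs : max (max A B) (max (A + B) 0) ≤ s)
    (hs' : (0 < A ∧ B ≤ 0) ∨ (0 < B ∧ A ≤ 0) ∨ (0 < A ∧ 0 < B ∧ p₁ = p₂) →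
      max (max A B) (max (A + B) 0) < s) :
    ∃ C : ℝ≥0∞, C ≠ ∞ ∧ ∀ G : Lattice d → Lattice d → ℝ≥0∞,
      lqNorm p₂ (fun k => lqNorm q₂ fun j => G j k) ≤
        C * lqNorm p₁ fun j => lqNorm q₁ fun k => G j k * dyadicWeight s (k - j) := by
  have hd' : (0 : ℝ) < d := by exact_mod_cast hd
  simp only [max_le_iff, max_lt_iff] at hs hs'
  obtain ⟨⟨hsA, hsB⟩, hsAB, hs0⟩ := hs
  have hA0 : A ≤ 0 → q₁ ≤ p₂ := fun h => by
    rw [hA] at h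
    exact (toReal_one_div_le_iff hp₂ hq₁).1 (by nlinarith)
  have hB0 : B ≤ 0 → p₁ ≤ q₂ := fun h => by
    rw [hB] at h
    exact (toReal_one_div_le_iff hq₂ hp₁).1 (by nlinarith)
  rcases le_or_gt A 0 with hA1 | hA1
  · rcases le_or_gt B 0 with hB1 | hB1
    · have := exists_lqNorm_lqNorm_le_of_add (d := d) hp₁ hq₁ hq₂ h12 le_rfl hs0
        (Or.inl (hB0 hB1)) (Or.inl (hA0 hA1))
      rwa [zero_add] at this
    · have := exists_lqNorm_lqNorm_le_of_add (d := d) hp₁ hq₁ hq₂ h12 hs0 le_rfl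
        (Or.inr (hB ▸ (hs' (Or.inr (Or.inl ⟨hB1, hA1⟩))).1.2)) (Or.inl (hA0 hA1))
      rwa [add_zero] at this
  · rcases le_or_gt B 0 with hB1 | hB1
    · have := exists_lqNorm_lqNorm_le_of_add (d := d) hp₁ hq₁ hq₂ h12 le_rfl hs0
        (Or.inl (hB0 hB1)) (Or.inr (hA ▸ (hs' (Or.inl ⟨hA1, hB1⟩)).1.1))
      rwa [zero_add] at this
    · rcases h12.eq_or_lt with h12' | h12'
      · have hlt := (hs' (Or.inr (Or.inr ⟨hA1, hB1, h12'⟩))).2.1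
        have := exists_lqNorm_lqNorm_le_of_add (d := d) hp₁ hq₁ hq₂ h12
          -- The slack $s-(A+B)>0$ is shared equally, so that both embeddings are strict.
          (s₁ := B + (s - (A + B)) / 2) (s₂ := A + (s - (A + B)) / 2) (by linarith) (by linarith)
          (Or.inr (by rw [← hB]; linarith)) (Or.inr (by rw [← hA]; linarith))
        ring_nf at this ⊢
        exact this
      -- Here $q_2<p_1<p_2<q_1$, the range of the endpoint estimate.
      · have h21 : q₂ < p₁ := by
          refine not_le.1 fun h => hB1.not_ge ?_
          have := (toReal_one_div_le_iff hq₂ hp₁).2 h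
          rw [hB]
          nlinarith
        have h22 : p₂ < q₁ := by
          refine not_le.1 fun h => hA1.not_ge ?_
          have := (toReal_one_div_le_iff hp₂ hq₁).2 h
          rw [hA]
          nlinarith
        obtain ⟨C, hC, h⟩ := exists_lqNorm_lqNorm_le_endpoint hd hq₂ h21 h12' h22
          (s := A + B) (by rw [hA, hB]; ring)
        refine ⟨C, hC, fun G => (h G).trans ?_⟩
        gcongr
        refine lqNorm_mono _ fun j => lqNorm_mono _ fun k => ?_
        gcongr
        exact dyadicWeight_mono hsAB _

end

/-! ### Necessity: test families. -/

section

variable {d : ℕ}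

/-- Converts the growth of test families into inequalities between exponents. -/
lemma le_of_natCast_rpow_le {a b : ℝ} {C : ℝ≥0∞} (hC : C ≠ ∞)
    (h : ∀ N : ℕ, 1 ≤ N → (N : ℝ≥0∞) ^ a ≤ C * (N : ℝ≥0∞) ^ b) : a ≤ b := by
  by_contra! hab
  have hδ : 0 < a - b := sub_pos.2 hab
  obtain ⟨N, hN⟩ := ENNReal.exists_nat_gt
    (ENNReal.rpow_ne_top_of_nonneg (inv_nonneg.2 hδ.le) hC)
  have hN0 : (N : ℝ≥0∞) ≠ 0 := (zero_le.trans_lt hN).ne'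
  have h1 := h N (Nat.one_le_iff_ne_zero.2 (by simpa using hN0))
  rw [ENNReal.rpow_inv_lt_iff hδ] at hN
  refine hN.not_ge ?_
  have hb0 : (N : ℝ≥0∞) ^ b ≠ 0 := by simp [ENNReal.rpow_eq_zero_iff, hN0]
  have hbt : (N : ℝ≥0∞) ^ b ≠ ∞ := ENNReal.rpow_ne_top_of_ne_zero hN0 (by simp)
  rw [← sub_add_cancel a b, ENNReal.rpow_add _ _ hN0 (by simp)] at h1
  exact (ENNReal.mul_le_mul_iff_left hb0 hbt).1 h1

lemma tsum_ite_dyadicWeight (t : ℝ) (N : ℕ) :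
    ∑' n : Lattice d, (if shellIndex n < N then dyadicWeight t n else 0)
      = ∑ i ∈ Finset.range N, ((shell d i).card : ℝ≥0∞) * 2 ^ (t * i) := by
  rw [tsum_eq_tsum_shell, tsum_eq_sum (s := Finset.range N)]
  · refine Finset.sum_congr rfl fun i hi => ?_
    rw [← nsmul_eq_mul, ← Finset.sum_const]
    refine Finset.sum_congr rfl fun n hn => ?_
    rw [mem_shell] at hn
    rw [hn, if_pos (Finset.mem_range.1 hi), dyadicWeight, hn]
  · intro i hi
    refine Finset.sum_eq_zero fun n hn => if_neg ?_
    rw [mem_shell] at hn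
    rwa [hn, ← Finset.mem_range]

/-- Necessity of the strict inequality for embeddings between weighted sequence spaces. -/
lemma lt_of_lqNorm_le_lqNorm_mul_dyadicWeight (hd : 1 ≤ d) {p q C : ℝ≥0∞} (hp : 0 < p)
    (hpq : p < q) (hC : C ≠ ∞) {s : ℝ}
    (h : ∀ (N : ℕ) (g : Lattice d → ℝ≥0), (∀ n, N ≤ shellIndex n → g n = 0) →
      lqNorm p (fun n => (g n : ℝ≥0∞)) ≤ C * lqNorm q fun n => g n * dyadicWeight s n) :
    d * ((1 / p).toReal - (1 / q).toReal) < s := by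
  by_contra! hs
  have hq := hp.trans hpq
  have hpt : p ≠ ∞ := hpq.ne_top
  have hP : 0 < p.toReal := ENNReal.toReal_pos hp.ne' hpt
  refine (mt (toReal_one_div_le_iff hp hq).1 (not_le.2 hpq)) ?_
  refine le_of_natCast_rpow_le (C := C * ((4 : ℝ≥0∞) ^ d) ^ (1 / q).toReal)
    (ENNReal.mul_ne_top hC (ENNReal.rpow_ne_top_of_nonneg ENNReal.toReal_nonneg (by simp)))
    fun N _ => ?_
  -- The critical power: each of the $N$ shells adds at least $1$ to the $p$-th power sum. If $s\le
  -- d(1/p-1/q)$ and $q<\infty$, each adds at most $4^d$ on the weighted side, so $N^{1/p}\lesssim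
  -- N^{1/q}$, which contradicts $p<q$.
  set τ : ℝ := -(d / p.toReal) with hτ
  have hg : ∀ n : Lattice d,
      (((if shellIndex n < N then (dyadicWeight τ n).toNNReal else 0 : ℝ≥0)) : ℝ≥0∞)
        = if shellIndex n < N then dyadicWeight τ n else 0 := fun n => by
    split_ifs
    · rw [ENNReal.coe_toNNReal (dyadicWeight_ne_top _ _)]
    · simp
  have h1 := h N (fun n => if shellIndex n < N then (dyadicWeight τ n).toNNReal else 0)
    (fun n hn => if_neg (not_lt.2 hn))
  simp only [hg, ite_mul, zero_mul, dyadicWeight_mul] at h1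
  rw [mul_assoc, ← ENNReal.mul_rpow_of_nonneg _ _ ENNReal.toReal_nonneg]
  refine le_trans ?_ (h1.trans (mul_le_mul_right ?_ _))
  · rw [lqNorm_of_ne_top hpt]
    simp only [one_div, ENNReal.toReal_inv]
    refine ENNReal.rpow_le_rpow ?_ (by positivity)
    simp only [ENNReal.zero_rpow_of_pos hP, dyadicWeight_rpow,
      apply_ite (fun x : ℝ≥0∞ => x ^ p.toReal)]
    rw [tsum_ite_dyadicWeight]
    calc (N : ℝ≥0∞) = ∑ i ∈ Finset.range N, 1 := by simp
      _ ≤ _ := Finset.sum_le_sum fun i _ => ?_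
    refine le_trans (le_of_eq ?_) (mul_le_mul_left (le_card_shell_cast hd i) _)
    have : τ * p.toReal = -d := by rw [hτ]; field_simp
    rw [this, ← ENNReal.rpow_add _ _ (by simp) (by simp)]
    simp
  · have hτs : τ + s ≤ -(d * (1 / q).toReal) := by
      rw [hτ]
      simp only [one_div, ENNReal.toReal_inv] at hs ⊢
      rw [div_eq_mul_inv]
      linarith
    by_cases hqt : q = ∞
    · subst hqt
      rw [lqNorm_top]
      simp only [one_div, ENNReal.inv_top, ENNReal.toReal_zero,
        ENNReal.rpow_zero, mul_zero, neg_zero] at hτs ⊢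
      refine iSup_le fun n => ?_
      split_ifs
      · exact (dyadicWeight_mono hτs n).trans_eq (dyadicWeight_zero n)
      · exact zero_le
    · have hQ : 0 < q.toReal := ENNReal.toReal_pos hq.ne' hqt
      rw [lqNorm_of_ne_top hqt]
      have e : (1 / q).toReal = 1 / q.toReal := by simp
      rw [e] at hτs ⊢
      refine ENNReal.rpow_le_rpow ?_ (by positivity)
      simp only [ENNReal.zero_rpow_of_pos hQ, dyadicWeight_rpow,
        apply_ite (fun x : ℝ≥0∞ => x ^ q.toReal)]
      rw [tsum_ite_dyadicWeight]
      calc _ ≤ ∑ i ∈ Finset.range N, (4 : ℝ≥0∞) ^ d := Finset.sum_le_sum fun i _ => ?_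
        _ = _ := by rw [Finset.sum_const, nsmul_eq_mul, Finset.card_range, mul_comm]
      refine (mul_le_mul_left (card_shell_cast_le d i) _).trans ?_
      rw [mul_assoc, ← ENNReal.rpow_add _ _ (by simp) (by simp)]
      refine mul_le_of_le_one_right' ?_
      rw [← ENNReal.rpow_zero (x := 2)]
      refine ENNReal.rpow_le_rpow_of_exponent_le (by norm_num) ?_
      rw [← add_mul]
      refine mul_nonpos_of_nonpos_of_nonneg ?_ (by positivity)
      have := mul_le_mul_of_nonneg_right hτs hQ.le
      have e2 : -(d * (1 / q.toReal)) * q.toReal = -d := by field_simp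
      linarith

/-- The estimate to be characterised, for the dyadic weight and finite families. -/
def DyadicBound (d : ℕ) (s : ℝ) (p₁ p₂ q₁ q₂ C : ℝ≥0∞) : Prop :=
  ∀ G : Lattice d → Lattice d → ℝ≥0,
    lqNorm p₂ (fun k => lqNorm q₂ fun j => (G j k : ℝ≥0∞)) ≤
      C * lqNorm p₁ fun j => lqNorm q₁ fun k => G j k * dyadicWeight s (k - j)

/-- The cube `[a, b)^d`. -/
noncomputable def cube (d : ℕ) (a b : ℤ) : Finset (Lattice d) := Fintype.piFinset fun _ => Finset.Ico a b

lemma card_cube {d : ℕ} (a b : ℤ) : (cube d a b).card = (b - a).toNat ^ d := by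
  simp [cube, Fintype.card_piFinset]

lemma cube_nonempty {a b : ℤ} (h : a < b) : (cube d a b).Nonempty := by
  simp [cube, Fintype.piFinset_nonempty, h]

lemma mem_cube {a b : ℤ} {n : Lattice d} : n ∈ cube d a b ↔ ∀ i, a ≤ n i ∧ n i < b := by
  simp [cube]

lemma shellIndex_zero : shellIndex (0 : Lattice d) = 0 := by
  simp [shellIndex]

lemma dyadicWeight_zero_right (s : ℝ) : dyadicWeight s (0 : Lattice d) = 1 := by
  simp [dyadicWeight, shellIndex_zero]

variable {s : ℝ} {p₁ p₂ q₁ q₂ C : ℝ≥0∞}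

/-- Tested on the diagonal of a cube of side $N$, where the weight is $1$. -/
lemma DyadicBound.le_exponent (hd : 1 ≤ d) (hp₁ : 0 < p₁) (hp₂ : 0 < p₂) (hq₁ : 0 < q₁)
    (hq₂ : 0 < q₂) (hC : C ≠ ∞) (h : DyadicBound d s p₁ p₂ q₁ q₂ C) : p₁ ≤ p₂ := by
  classical
  have hd' : (0 : ℝ) < d := by exact_mod_cast hd
  rw [← toReal_one_div_le_iff hp₂ hp₁]
  refine le_of_mul_le_mul_left ?_ hd'
  refine le_of_natCast_rpow_le hC fun N hN => ?_
  have h1 := h fun j k => if j = k then if k ∈ cube d 0 N then 1 else 0 else 0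
  have e1 : ∀ k : Lattice d, lqNorm q₂ (fun j => (((if j = k then if k ∈ cube d 0 N then 1 else 0
      else 0 : ℝ≥0)) : ℝ≥0∞)) = if k ∈ cube d 0 N then 1 else 0 := fun k => by
    rw [lqNorm_single hq₂ k _ (fun j hj => by simp [hj])]
    simp [apply_ite ((↑) : ℝ≥0 → ℝ≥0∞)]
  have e2 : ∀ j : Lattice d, lqNorm q₁ (fun k => (((if j = k then if k ∈ cube d 0 N then 1 else 0
      else 0 : ℝ≥0)) : ℝ≥0∞) * dyadicWeight s (k - j)) = if j ∈ cube d 0 N then 1 else 0 :=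
    fun j => by
    rw [lqNorm_single hq₁ j _ (fun k hk => by simp [hk.symm])]
    simp [dyadicWeight_zero_right, apply_ite ((↑) : ℝ≥0 → ℝ≥0∞)]
  have hN' : (0 : ℤ) < N := by exact_mod_cast hN
  have e3 := lqNorm_indicator hp₁ (cube d 0 N) (cube_nonempty hN') 1
  have e4 := lqNorm_indicator hp₂ (cube d 0 N) (cube_nonempty hN') 1
  rw [card_cube] at e3 e4
  simp only [e1, e2] at h1
  rw [e3, e4] at h1
  simpa [ENNReal.rpow_mul] using h1

/-- For $G$ supported on $j=0$ the bound is an embedding of weighted $l^{q_1}$ into $l^{p_2}$. -/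
lemma DyadicBound.lt_of_row (hd : 1 ≤ d) (hp₁ : 0 < p₁) (hp₂ : 0 < p₂) (hq₁ : 0 < q₁)
    (hq₂ : 0 < q₂) (hC : C ≠ ∞) (h : DyadicBound d s p₁ p₂ q₁ q₂ C) (h' : p₂ < q₁) :
    d * ((1 / p₂).toReal - (1 / q₁).toReal) < s := by
  classical
  refine lt_of_lqNorm_le_lqNorm_mul_dyadicWeight hd hp₂ h' hC fun N g _ => ?_
  have h1 := h fun j k => if j = 0 then g k else 0
  rw [lqNorm_single hp₁ 0 _ (fun j hj => by simp [hj, lqNorm_zero hq₁])] at h1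
  have e1 : ∀ k : Lattice d, lqNorm q₂ (fun j : Lattice d => (((if j = 0 then g k else 0 : ℝ≥0)) :
      ℝ≥0∞)) = g k := fun k => by
    rw [lqNorm_single hq₂ 0 _ (fun j hj => by simp [hj])]
    simp
  simpa only [e1, if_true, sub_zero] using h1

/-- For $G$ supported on $k=0$ the bound is an embedding of weighted $l^{p_1}$ into $l^{q_2}$. -/
lemma DyadicBound.lt_of_column (hd : 1 ≤ d) (hp₂ : 0 < p₂) (hq₁ : 0 < q₁)
    (hq₂ : 0 < q₂) (hC : C ≠ ∞) (h : DyadicBound d s p₁ p₂ q₁ q₂ C) (h' : q₂ < p₁) :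
    d * ((1 / q₂).toReal - (1 / p₁).toReal) < s := by
  classical
  refine lt_of_lqNorm_le_lqNorm_mul_dyadicWeight hd hq₂ h' hC fun N g _ => ?_
  have h1 := h fun j k => if k = 0 then g j else 0
  rw [lqNorm_single hp₂ 0 _ (fun j hj => by simp [hj, lqNorm_zero hq₂])] at h1
  have e1 : ∀ j : Lattice d, lqNorm q₁ (fun k : Lattice d => (((if k = 0 then g j else 0 : ℝ≥0)) :
      ℝ≥0∞) * dyadicWeight s (k - j)) = g j * dyadicWeight s j := fun j => by
    rw [lqNorm_single hq₁ 0 _ (fun k hk => by simp [hk])]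
    simp [dyadicWeight_neg_arg]
  simpa only [e1, if_true] using h1

/-- Tested on the indicator of $Q\times Q$ for a cube $Q$ of side $N$; as $s\ge0$, the weight is at
most $N^s$ there. -/
lemma DyadicBound.add_le (hs : 0 ≤ s) (hp₁ : 0 < p₁) (hp₂ : 0 < p₂) (hq₁ : 0 < q₁)
    (hq₂ : 0 < q₂) (hC : C ≠ ∞) (h : DyadicBound d s p₁ p₂ q₁ q₂ C) :
    d * (1 / p₂).toReal + d * (1 / q₂).toReal
      ≤ d * (1 / p₁).toReal + (d * (1 / q₁).toReal + s) := by
  classical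
  refine le_of_natCast_rpow_le hC fun N hN => ?_
  have hN' : (0 : ℤ) < N := by exact_mod_cast hN
  have hN0 : (N : ℝ≥0∞) ≠ 0 := by simpa using (Nat.one_le_iff_ne_zero.1 hN)
  set Q := cube d 0 N with hQ
  have hne : Q.Nonempty := cube_nonempty hN'
  have hcard : ∀ {p : ℝ≥0∞}, (Q.card : ℝ≥0∞) ^ (1 / p).toReal = (N : ℝ≥0∞) ^ (d * (1 / p).toReal) :=
    fun {p} => by simp [hQ, card_cube, ENNReal.rpow_mul]
  have h1 := h fun j k => if k ∈ Q then if j ∈ Q then 1 else 0 else 0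
  have e1 : ∀ k : Lattice d, lqNorm q₂ (fun j => (((if k ∈ Q then if j ∈ Q then 1 else 0
      else 0 : ℝ≥0)) : ℝ≥0∞))
      = if k ∈ Q then (N : ℝ≥0∞) ^ (d * (1 / q₂).toReal) else 0 := fun k => by
    split_ifs
    · rw [← hcard, ← mul_one ((Q.card : ℝ≥0∞) ^ _), ← lqNorm_indicator hq₂ Q hne]
      congr 1
      ext j
      split_ifs <;> simp
    · simpa using lqNorm_zero hq₂
  have e2 : ∀ j : Lattice d, lqNorm q₁ (fun k => (((if k ∈ Q then if j ∈ Q then 1 else 0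
      else 0 : ℝ≥0)) : ℝ≥0∞) * dyadicWeight s (k - j))
      ≤ if j ∈ Q then (N : ℝ≥0∞) ^ (d * (1 / q₁).toReal + s) else 0 := fun j => by
    split_ifs with hj
    · rw [ENNReal.rpow_add _ _ hN0 (by simp), ← hcard, ← lqNorm_indicator hq₁ Q hne]
      refine lqNorm_mono _ fun k => ?_
      by_cases hk : k ∈ Q
      · simp only [hk, if_true, ENNReal.coe_one, one_mul]
        rw [dyadicWeight, mul_comm, ENNReal.rpow_mul, ENNReal.rpow_natCast]
        refine ENNReal.rpow_le_rpow ?_ hs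
        -- Coordinates of $k-j$ are at most $N-1$ in size, which absorbs the $1$ in `shellIndex`.
        have hle : 2 ^ shellIndex (k - j) ≤ N := by
          refine (two_pow_shellIndex_le _).trans ?_
          have : (Finset.univ.sup fun i => ((k - j) i).natAbs) ≤ N - 1 := by
            refine Finset.sup_le fun i _ => ?_
            have a1 := mem_cube.1 hk i
            have a2 := mem_cube.1 hj i
            simp only [Pi.sub_apply]
            omega
          omega
        exact_mod_cast hle
      · simp [hk]
    · simp [lqNorm_zero hq₁]
  simp only [e1] at h1
  have h2 := h1.trans (mul_le_mul_right (lqNorm_mono p₁ e2) C)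
  have e3 := lqNorm_indicator hp₁ Q hne ((N : ℝ≥0∞) ^ (d * (1 / q₁).toReal + s))
  have e4 := lqNorm_indicator hp₂ Q hne ((N : ℝ≥0∞) ^ (d * (1 / q₂).toReal))
  rw [hcard, ← ENNReal.rpow_add _ _ hN0 (by simp)] at e3 e4
  rw [← e3, ← e4]
  exact h2

/-- Tested on $G_{j,k}=g(k-j)$ with $j$ in a cube of side $3M$, where $g$ lives in $|n|_\infty<M$.
For $k$ in the middle cube of side $M$ the whole of $g$ is seen. As the outer exponents agree, the
powers of $M$ cancel, and an embedding of weighted $l^{q_1}$ into $l^{q_2}$ remains. -/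
lemma DyadicBound.lt_of_convolution (hd : 1 ≤ d) (hp₁ : 0 < p₁)
    (hq₂ : 0 < q₂) (hC : C ≠ ∞) (h : DyadicBound d s p₁ p₁ q₁ q₂ C) (h' : q₂ < q₁) (hq₁ : 0 < q₁) :
    d * ((1 / q₂).toReal - (1 / q₁).toReal) < s := by
  classical
  refine lt_of_lqNorm_le_lqNorm_mul_dyadicWeight hd hq₂ h'
    (C := C * (((3 : ℕ) ^ d : ℕ) : ℝ≥0∞) ^ (1 / p₁).toReal)
    (ENNReal.mul_ne_top hC (ENNReal.rpow_ne_top_of_nonneg ENNReal.toReal_nonneg (by simp)))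
    fun N g hg => ?_
  set M : ℕ := 2 ^ N with hM
  have hMpos : (0 : ℤ) < M := by positivity
  have h1 := h fun j k => if j ∈ cube d (-M) (2 * M) then g (k - j) else 0
  have e1 : ∀ k : Lattice d, (if k ∈ cube d 0 M then lqNorm q₂ (fun n => (g n : ℝ≥0∞)) else 0) ≤
      lqNorm q₂ (fun j => (((if j ∈ cube d (-M) (2 * M) then g (k - j) else 0 : ℝ≥0)) : ℝ≥0∞)) := by
    intro k
    split_ifs with hk
    · rw [← lqNorm_comp_equiv q₂ (Equiv.subLeft k)]
      refine lqNorm_mono _ fun j => ?_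
      rw [Equiv.subLeft_apply]
      by_cases hj : N ≤ shellIndex (k - j)
      · simp [hg _ hj]
      · rw [if_pos]
        refine mem_cube.2 fun i => ?_
        have a1 := mem_cube.1 hk i
        have a2 := natAbs_lt_two_pow_shellIndex (k - j) i
        have a3 : 2 ^ (shellIndex (k - j) + 1) ≤ M := Nat.pow_le_pow_right two_pos (by omega)
        simp only [Pi.sub_apply] at a2
        omega
    · exact zero_le
  have e2 : ∀ j : Lattice d, lqNorm q₁ (fun k => (((if j ∈ cube d (-M) (2 * M) then g (k - j)
      else 0 : ℝ≥0)) : ℝ≥0∞) * dyadicWeight s (k - j)) =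
      if j ∈ cube d (-M) (2 * M) then lqNorm q₁ (fun n => g n * dyadicWeight s n) else 0 := by
    intro j
    split_ifs with hj
    · exact lqNorm_comp_equiv q₁ (Equiv.subRight j) fun n => g n * dyadicWeight s n
    · simp [lqNorm_zero hq₁]
  simp only [e2] at h1
  have h2 := (lqNorm_mono p₁ e1).trans h1
  have e3 := lqNorm_indicator hp₁ (cube d 0 M) (cube_nonempty hMpos)
    (lqNorm q₂ fun n => (g n : ℝ≥0∞))
  have e4 := lqNorm_indicator hp₁ (cube d (-M) (2 * M)) (cube_nonempty (by linarith))
    (lqNorm q₁ fun n => g n * dyadicWeight s n)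
  have h3 : ((cube d 0 M).card : ℝ≥0∞) ^ (1 / p₁).toReal * lqNorm q₂ (fun n => (g n : ℝ≥0∞))
      ≤ C * (((cube d (-M) (2 * M)).card : ℝ≥0∞) ^ (1 / p₁).toReal *
        lqNorm q₁ fun n => g n * dyadicWeight s n) := by
    rw [← e3, ← e4]
    exact h2
  have c1 : (cube d 0 M).card = M ^ d := by simp [card_cube]
  have c2 : (cube d (-M) (2 * M)).card = 3 ^ d * M ^ d := by
    rw [card_cube, ← mul_pow]
    congr 1
    omega
  rw [c1, c2, Nat.cast_mul, ENNReal.mul_rpow_of_nonneg _ _ ENNReal.toReal_nonneg] at h3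
  have hM0 : ((M ^ d : ℕ) : ℝ≥0∞) ≠ 0 := by simp [hM]
  refine (ENNReal.mul_le_mul_iff_right (a := ((M ^ d : ℕ) : ℝ≥0∞) ^ (1 / p₁).toReal)
    (ENNReal.rpow_pos (pos_iff_ne_zero.2 hM0) (by simp)).ne'
    (ENNReal.rpow_ne_top_of_ne_zero hM0 (by simp))).1 (h3.trans (le_of_eq (by ring)))

end

/-! ### From the shear and the power weight to the dyadic estimate. -/

section

variable {d : ℕ}

/-- The power weight at lattice points, with values in `[0, ∞]`. -/
noncomputable def latticeWeight (s : ℝ) (n : Lattice d) : ℝ≥0∞ :=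
  ENNReal.ofReal (powerWeight s (toEuclid n))

lemma powerWeight_eq_sqrt_rpow (s : ℝ) (ξ : EuclideanSpace ℝ (Fin d)) :
    powerWeight s ξ = √(1 + ‖ξ‖ ^ 2) ^ s := by
  rw [powerWeight, Real.sqrt_eq_rpow, ← Real.rpow_mul (by positivity)]
  ring_nf

lemma dyadicWeight_eq_ofReal (s : ℝ) (n : Lattice d) :
    dyadicWeight s n = ENNReal.ofReal (((2 : ℝ) ^ shellIndex n) ^ s) := by
  rw [← ENNReal.ofReal_rpow_of_pos (by positivity), dyadicWeight, mul_comm, ENNReal.rpow_mul,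
    ENNReal.rpow_natCast, ENNReal.ofReal_pow (by norm_num)]
  simp

lemma two_pow_shellIndex_le_sqrt (n : Lattice d) :
    (2 : ℝ) ^ shellIndex n ≤ 2 * √(1 + ‖toEuclid n‖ ^ 2) := by
  set J := √(1 + ‖toEuclid n‖ ^ 2) with hJ
  have h1 : 1 ≤ J := Real.one_le_sqrt.2 (by nlinarith [sq_nonneg ‖toEuclid n‖])
  have h2 : ‖toEuclid n‖ ≤ J := Real.le_sqrt_of_sq_le (by linarith)
  have h3 : (Finset.univ.sup fun i => (n i).natAbs) ≤ ⌊J⌋₊ := by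
    refine Finset.sup_le fun i _ => Nat.le_floor ?_
    have := PiLp.norm_apply_le (toEuclid n) i
    refine le_trans (le_of_eq ?_) (this.trans h2)
    rw [toEuclid, Real.norm_eq_abs, Nat.cast_natAbs, Int.cast_abs]
  have h4 : ((2 ^ shellIndex n : ℕ) : ℝ) ≤ ((1 + ⌊J⌋₊ : ℕ) : ℝ) :=
    Nat.cast_le.2 ((two_pow_shellIndex_le n).trans (by omega))
  push_cast at h4
  linarith [Nat.floor_le (zero_le_one.trans h1)]

lemma sqrt_le_two_pow_shellIndex (n : Lattice d) :
    √(1 + ‖toEuclid n‖ ^ 2) ≤ (1 + 2 * √d) * 2 ^ shellIndex n := by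
  set m := 2 ^ (shellIndex n + 1) with hm
  have h1 : ‖toEuclid n‖ ≤ √d * m := by
    rw [EuclideanSpace.norm_eq]
    refine Real.sqrt_le_iff.2 ⟨by positivity, ?_⟩
    rw [mul_pow, Real.sq_sqrt (by positivity)]
    calc ∑ i, ‖toEuclid n i‖ ^ 2 ≤ ∑ _i : Fin d, (m : ℝ) ^ 2 := Finset.sum_le_sum fun i _ => ?_
      _ = _ := by simp
    have := natAbs_lt_two_pow_shellIndex n i
    gcongr
    rw [toEuclid, Real.norm_eq_abs, ← Int.cast_abs, ← Nat.cast_natAbs]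
    exact_mod_cast this.le
  have h2 : (1 : ℝ) ≤ 2 ^ shellIndex n := one_le_pow₀ (by norm_num)
  have h3 : (m : ℝ) = 2 * 2 ^ shellIndex n := by rw [hm]; push_cast; ring
  have h4 : √(1 + ‖toEuclid n‖ ^ 2) ≤ 1 + ‖toEuclid n‖ :=
    Real.sqrt_le_iff.2 ⟨by positivity, by nlinarith [norm_nonneg (toEuclid n)]⟩
  rw [h3] at h1
  nlinarith

lemma dyadicWeight_le_latticeWeight {s : ℝ} (hs : 0 ≤ s) (n : Lattice d) :
    dyadicWeight s n ≤ ENNReal.ofReal (2 ^ s) * latticeWeight s n := by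
  rw [dyadicWeight_eq_ofReal, latticeWeight, ← ENNReal.ofReal_mul (by positivity),
    powerWeight_eq_sqrt_rpow, ← Real.mul_rpow (by norm_num) (by positivity)]
  exact ENNReal.ofReal_le_ofReal
    (Real.rpow_le_rpow (by positivity) (two_pow_shellIndex_le_sqrt n) hs)

lemma latticeWeight_le_dyadicWeight {s : ℝ} (hs : 0 ≤ s) (n : Lattice d) :
    latticeWeight s n ≤ ENNReal.ofReal ((1 + 2 * √d) ^ s) * dyadicWeight s n := by
  rw [dyadicWeight_eq_ofReal, latticeWeight, ← ENNReal.ofReal_mul (by positivity),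
    powerWeight_eq_sqrt_rpow, ← Real.mul_rpow (by positivity) (by positivity)]
  exact ENNReal.ofReal_le_ofReal
    (Real.rpow_le_rpow (by positivity) (sqrt_le_two_pow_shellIndex n) hs)

/-- Needed only to exclude $s<0$. -/
lemma latticeWeight_le_dyadicWeight_of_nonpos {s : ℝ} (hs : s ≤ 0) (n : Lattice d) :
    latticeWeight s n ≤ ENNReal.ofReal (2 ^ (-s)) * dyadicWeight s n := by
  have hJ : 0 < √(1 + ‖toEuclid n‖ ^ 2) := Real.sqrt_pos.2 (by positivity)
  rw [dyadicWeight_eq_ofReal, latticeWeight, ← ENNReal.ofReal_mul (by positivity),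
    powerWeight_eq_sqrt_rpow]
  refine ENNReal.ofReal_le_ofReal ?_
  have h := Real.rpow_le_rpow_of_nonpos (by positivity) (two_pow_shellIndex_le_sqrt n) hs
  rw [Real.mul_rpow (by norm_num) hJ.le] at h
  calc √(1 + ‖toEuclid n‖ ^ 2) ^ s
      = 2 ^ (-s) * (2 ^ s * √(1 + ‖toEuclid n‖ ^ 2) ^ s) := by
        rw [← mul_assoc, ← Real.rpow_add (by norm_num)]
        simp
    _ ≤ _ := by gcongr

lemma mixedNorm_shear (p q : ℝ≥0∞) (a : Seq d) :
    mixedNorm p q (fun _ _ => 1) (shear d a) =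
      lqNorm p fun k => lqNorm q fun j => ENNReal.ofReal ‖a j (k - j)‖ := by
  refine congrArg (lqNorm p) (funext fun k => ?_)
  rw [← lqNorm_comp_equiv q (Equiv.subLeft k)]
  simp [shear]

lemma mixedNorm_oneTensorPower (p q : ℝ≥0∞) (s : ℝ) (a : Seq d) :
    mixedNorm p q (oneTensorPower s) a =
      lqNorm p fun j => lqNorm q fun k =>
        ENNReal.ofReal ‖a j (k - j)‖ * latticeWeight s (k - j) := by
  refine congrArg (lqNorm p) (funext fun j => ?_)
  rw [← lqNorm_comp_equiv q (Equiv.subRight j)]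
  simp only [Equiv.subRight_apply, ENNReal.ofReal_mul (norm_nonneg _)]
  rfl

variable {s : ℝ} {p₁ p₂ q₁ q₂ : ℝ≥0∞}

/-- Boundedness of the shear as an embedding of mixed norm spaces with exchanged variables. -/
lemma isBoundedMap_of_lqNorm_le {C : ℝ≥0∞} (hC : C ≠ ∞)
    (h : ∀ G : Lattice d → Lattice d → ℝ≥0∞, lqNorm p₂ (fun k => lqNorm q₂ fun j => G j k) ≤
      C * lqNorm p₁ fun j => lqNorm q₁ fun k => G j k * latticeWeight s (k - j)) :
    IsBoundedMap (shear d) p₁ q₁ (oneTensorPower s) p₂ q₂ (fun _ _ => 1) := by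
  refine ⟨C.toNNReal, fun a ha => ?_⟩
  have h1 : mixedNorm p₂ q₂ (fun _ _ => 1) (shear d a) ≤
      C.toNNReal * mixedNorm p₁ q₁ (oneTensorPower s) a := by
    rw [ENNReal.coe_toNNReal hC, mixedNorm_shear, mixedNorm_oneTensorPower]
    exact h fun j k => ENNReal.ofReal ‖a j (k - j)‖
  exact ⟨h1.trans_lt (ENNReal.mul_lt_top (by simp) ha), h1⟩

lemma IsBoundedMap.exists_lqNorm_le
    (h : IsBoundedMap (shear d) p₁ q₁ (oneTensorPower s) p₂ q₂ (fun _ _ => 1)) :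
    ∃ C : ℝ≥0∞, C ≠ ∞ ∧ ∀ G : Lattice d → Lattice d → ℝ≥0,
      lqNorm p₂ (fun k => lqNorm q₂ fun j => (G j k : ℝ≥0∞)) ≤
        C * lqNorm p₁ fun j => lqNorm q₁ fun k => G j k * latticeWeight s (k - j) := by
  obtain ⟨C, h⟩ := h
  -- With a nonzero constant the bound is trivial when the sequence lies outside the source space.
  refine ⟨C + 1, by simp, fun G => ?_⟩
  set a : Seq d := fun j n => ((G j (j + n) : ℝ) : ℂ) with ha
  have hG : ∀ j k, ENNReal.ofReal ‖a j (k - j)‖ = G j k := fun j k => by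
    simp [ha]
  have h1 := mixedNorm_shear p₂ q₂ a
  have h2 := mixedNorm_oneTensorPower p₁ q₁ s a
  simp only [hG] at h1 h2
  rw [← h1, ← h2]
  by_cases hfin : a ∈ mixedSpace p₁ q₁ (oneTensorPower s)
  · exact (h a hfin).2.trans (by gcongr; exact le_self_add)
  · have : mixedNorm p₁ q₁ (oneTensorPower s) a = ∞ := not_lt_top_iff.1 hfin
    rw [this, ENNReal.mul_top (by simp)]
    exact le_top

/-- A single entry at $(0,n)$ gives $1\le C\,v_s(n)$ for every $n$. If $s<0$, summing this over one
point per shell bounds a divergent series by a convergent geometric one. -/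
lemma nonneg_of_isBoundedMap (hd : 1 ≤ d) (hp₁ : 0 < p₁) (hp₂ : 0 < p₂) (hq₁ : 0 < q₁)
    (hq₂ : 0 < q₂) (h : IsBoundedMap (shear d) p₁ q₁ (oneTensorPower s) p₂ q₂ (fun _ _ => 1)) :
    0 ≤ s := by
  classical
  by_contra! hs
  obtain ⟨C, hC, h⟩ := h.exists_lqNorm_le
  have h1 : ∀ n : Lattice d, 1 ≤ C * latticeWeight s n := fun n => by
    have := h fun j k => if j = 0 then if k = n then 1 else 0 else 0
    rw [lqNorm_single hp₂ n _ (fun k hk => by simp [hk, lqNorm_zero hq₂]),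
      lqNorm_single hq₂ 0 _ (fun j hj => by simp [hj]),
      lqNorm_single hp₁ 0 _ (fun j hj => by simp [hj, lqNorm_zero hq₁]),
      lqNorm_single hq₁ n _ (fun k hk => by simp [hk])] at this
    simpa using this
  have h2 : ∀ i : ℕ, 1 ≤ C * ENNReal.ofReal (2 ^ (-s)) * (2 : ℝ≥0∞) ^ (-(-s) * i) := fun i => by
    obtain ⟨n, hn⟩ : (shell d i).Nonempty :=
      Finset.card_pos.1 ((by positivity : 0 < (2 ^ i) ^ d).trans_le (le_card_shell hd i))
    have := (h1 n).trans (mul_le_mul_right (latticeWeight_le_dyadicWeight_of_nonpos hs.le n) C)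
    rwa [dyadicWeight, mem_shell.1 hn, ← mul_assoc, ← neg_neg s, neg_neg (-s)] at this
  have h3 := ENNReal.tsum_le_tsum h2
  rw [ENNReal.tsum_mul_left, ENNReal.tsum_const_eq_top_of_ne_zero one_ne_zero, top_le_iff] at h3
  exact ENNReal.mul_ne_top (ENNReal.mul_ne_top hC (by simp))
    (tsum_two_rpow_neg (neg_pos.2 hs)) h3

lemma IsBoundedMap.exists_dyadicBound (hp₁ : 0 < p₁) (hq₁ : 0 < q₁) (hs : 0 ≤ s)
    (h : IsBoundedMap (shear d) p₁ q₁ (oneTensorPower s) p₂ q₂ (fun _ _ => 1)) :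
    ∃ C : ℝ≥0∞, C ≠ ∞ ∧ DyadicBound d s p₁ p₂ q₁ q₂ C := by
  obtain ⟨C, hC, h⟩ := h.exists_lqNorm_le
  refine ⟨C * ENNReal.ofReal ((1 + 2 * √d) ^ s), ENNReal.mul_ne_top hC (by simp), fun G => ?_⟩
  refine (h G).trans ?_
  rw [mul_assoc]
  gcongr
  rw [← lqNorm_const_mul hp₁]
  refine lqNorm_mono _ fun j => ?_
  rw [← lqNorm_const_mul hq₁]
  refine lqNorm_mono _ fun k => ?_
  rw [mul_left_comm]
  gcongr
  exact latticeWeight_le_dyadicWeight hs _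

end

end ShearMixedNorm

/-! ### The characterisation. -/

open ShearMixedNorm in
theorem proposition4 (d : ℕ) (hd : 1 ≤ d) (s : ℝ) (p₁ p₂ q₁ q₂ : ℝ≥0∞)
    (hp₁ : 0 < p₁) (hp₂ : 0 < p₂) (hq₁ : 0 < q₁) (hq₂ : 0 < q₂)
    (A B : ℝ)
    (hA : A = d * ((1 / p₂).toReal - (1 / q₁).toReal))
    (hB : B = d * ((1 / q₂).toReal - (1 / p₁).toReal)) :
    ShearMixedNorm.IsBoundedMap (ShearMixedNorm.shear d)
        p₁ q₁ (ShearMixedNorm.oneTensorPower s) p₂ q₂ (fun _ _ => 1) ↔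
      1 / p₂ ≤ 1 / p₁ ∧
      max (max A B) (max (A + B) 0) ≤ s ∧
      ((0 < A ∧ B ≤ 0) ∨ (0 < B ∧ A ≤ 0) ∨ (0 < A ∧ 0 < B ∧ p₁ = p₂) →
        max (max A B) (max (A + B) 0) < s) := by
  have hd' : (0 : ℝ) < d := by exact_mod_cast hd
  rw [show 1 / p₂ ≤ 1 / p₁ ↔ p₁ ≤ p₂ by simp]
  constructor
  · intro h
    -- This comes before the other tests, because the passage to the dyadic weight uses $s\ge0$.
    have hs := nonneg_of_isBoundedMap hd hp₁ hp₂ hq₁ hq₂ h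
    obtain ⟨C, hC, hD⟩ := IsBoundedMap.exists_dyadicBound hp₁ hq₁ hs h
    have hAlt : 0 < A → A < s := fun h0 => by
      rw [hA] at h0 ⊢
      refine hD.lt_of_row hd hp₁ hp₂ hq₁ hq₂ hC (not_le.1 fun hle => ?_)
      have := (toReal_one_div_le_iff hp₂ hq₁).2 hle
      nlinarith
    have hBlt : 0 < B → B < s := fun h0 => by
      rw [hB] at h0 ⊢
      refine hD.lt_of_column hd hp₂ hq₁ hq₂ hC (not_le.1 fun hle => ?_)
      have := (toReal_one_div_le_iff hq₂ hp₁).2 hle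
      nlinarith
    have hABle : A + B ≤ s := by
      have := hD.add_le hs hp₁ hp₂ hq₁ hq₂ hC
      rw [hA, hB]
      linarith
    have hAle : A ≤ s := (le_or_gt A 0).elim (fun h => h.trans hs) fun h => (hAlt h).le
    have hBle : B ≤ s := (le_or_gt B 0).elim (fun h => h.trans hs) fun h => (hBlt h).le
    refine ⟨hD.le_exponent hd hp₁ hp₂ hq₁ hq₂ hC,
      max_le (max_le hAle hBle) (max_le hABle hs), ?_⟩
    rintro (⟨h1, h2⟩ | ⟨h1, h2⟩ | ⟨h1, h2, rfl⟩)
    · have := hAlt h1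
      refine max_lt (max_lt ?_ ?_) (max_lt ?_ ?_) <;> linarith
    · have := hBlt h1
      refine max_lt (max_lt ?_ ?_) (max_lt ?_ ?_) <;> linarith
    · have : A + B < s := by
        have e : A + B = d * ((1 / q₂).toReal - (1 / q₁).toReal) := by rw [hA, hB]; ring
        rw [e]
        refine hD.lt_of_convolution hd hp₁ hq₂ hC (not_le.1 fun hle => ?_) hq₁
        have := (toReal_one_div_le_iff hq₂ hq₁).2 hle
        nlinarith
      refine max_lt (max_lt ?_ ?_) (max_lt ?_ ?_) <;> linarith
  · rintro ⟨h12, hs, hs'⟩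
    have hs0 : 0 ≤ s := (le_max_right _ _).trans ((le_max_right _ _).trans hs)
    obtain ⟨C, hC, h⟩ := exists_lqNorm_lqNorm_le hd hp₁ hp₂ hq₁ hq₂ h12 hA hB hs hs'
    refine isBoundedMap_of_lqNorm_le (C := C * ENNReal.ofReal (2 ^ s))
      (ENNReal.mul_ne_top hC (by simp)) fun G => (h G).trans ?_
    rw [mul_assoc]
    gcongr
    rw [← lqNorm_const_mul hp₁]
    refine lqNorm_mono _ fun j => ?_
    rw [← lqNorm_const_mul hq₁]
    refine lqNorm_mono _ fun k => ?_
    rw [mul_left_comm]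
    gcongr
    exact dyadicWeight_le_latticeWeight hs0 _
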